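/- **Setting.** Let $T>0$, let $\mathcal U\subseteq\mathbb R^{m}$ be convex, and let $f(x,u)=f_1(x)+f_2(x)u$ be bounded and Lipschitz on $\mathbb R^n\times\mathcal U$ with values in $\mathbb R^n$. A control signal on $[t,T)$ is a measurable $\mathbf u:[t,T)\to\mathcal U$, and $\xi=\xi^{\mathbf u}_{x,t}:[t,T]\to\mathbb R^n$ denotes the (absolutely continuous) solution of $\dot\xi=f(\xi,\mathbf u)$, $\xi(t)=x$. Let $\mathcal X\subseteq\mathbb R^n$ be a state space for this system, i.e. $\xi^{\mathbf u}_{x,t}$ stays in $\mathcal X$ on $[t,T]$ for all $x\in\mathcal X$, $t\in[0,T]$ and all control signals $\mathbf u$ (for instance $\mathcal X=\mathbb R^n$). Let $r:\mathcal X\times\mathcal U\to\mathbb R$ and $\phi:\mathcal X\to\mathbb R$ be bounded and Lipschitz, $r$ convex in $u$, and let $l:\mathcal X\to\mathbb R$ be Lipschitz (the safety constraint is $l\ge 0$). Put $$V_s(x,t)=\sup_{\mathbf u}\min_{\tau\in[t,T]} l(\xi^{\mathbf u}_{x,t}(\tau)).$$ For $(x,t)\in\mathcal X\times[0,T)$ the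 maximal set of safe controls is $$U_s^*(x,t)=\{u\in\mathcal U:\ \lim_{\varepsilon\to0^+}V_s(\xi^{u}_{x,t}(t+\varepsilon),t+\varepsilon)\ge 0\},$$ where $u$ is also used for the constant control signal. Let $$V(x,t)=\inf\Big\{\int_t^T r(\xi^{\mathbf u}_{x,t}(\tau),\mathbf u(\tau))\,d\tau+\phi(\xi^{\mathbf u}_{x,t}(T))\ :\ \mathbf u(\tau)\in U_s^*(\xi^{\mathbf u}_{x,t}(\tau),\tau)\ \ \forall\tau\in[t,T)\Big\}\in[-\infty,+\infty],$$ with $\inf\emptyset=+\infty$, and let $D$ be the set of all $(x,t)\in\mathcal X\times[0,T)$ with $U_s^*(x,t)\neq\emptyset$ (so $D=\mathcal X\times[0,T)$ if $U_s^*$ has nonempty values). **Theorem.** Assume that the set-valued map $(x,t)\mapsto U_s^*(x,t)$ is lower hemicontinuous on $\mathcal X\times[0,T)$. Then $V$ is a viscosity solution of the final-value problem $$\frac{\partial V}{\partial t}+\inf_{u\in U_s^*(x,t)}\{f(x,u)\cdot\nabla_xV+r(x,u)\}=0\quad\text{on }D,\qquad V(x,T)=\phi(x)\quad\text{for all }x\in\mathcal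 X.$$ That is: $V(x,T)=\phi(x)$ for all $x\in\mathcal X$; $V$ is finite, bounded and uniformly continuous on $D\cup(\mathcal X\times\{T\})$; and for every $(x_0,t_0)\in D$ and every real-valued $\psi$ that is $C^1$ in a neighbourhood of $(x_0,t_0)$ in $\mathbb R^n\times\mathbb R$, 1. if $V-\psi$ has a local maximum at $(x_0,t_0)$ relative to $\mathcal X\times[0,T]$, then $\partial_t\psi(x_0,t_0)+\inf_{u\in U_s^*(x_0,t_0)}\{f(x_0,u)\cdot\nabla_x\psi(x_0,t_0)+r(x_0,u)\}\ge 0$; 2. if $V-\psi$ has a local minimum at $(x_0,t_0)$ relative to $\mathcal X\times[0,T]$, then $\partial_t\psi(x_0,t_0)+\inf_{u\in U_s^*(x_0,t_0)}\{f(x_0,u)\cdot\nabla_x\psi(x_0,t_0)+r(x_0,u)\}\le 0$. -/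

import Mathlib

open Set Filter Topology

noncomputable section

/-- The control-affine dynamics `f(x,u) = f₁(x) + f₂(x) u`. -/
def affineDynamics {n m : ℕ}
    (f₁ : EuclideanSpace ℝ (Fin n) → EuclideanSpace ℝ (Fin n))
    (f₂ : EuclideanSpace ℝ (Fin n) → EuclideanSpace ℝ (Fin m) →L[ℝ] EuclideanSpace ℝ (Fin n))
    (x : EuclideanSpace ℝ (Fin n)) (u : EuclideanSpace ℝ (Fin m)) : EuclideanSpace ℝ (Fin n) :=
  f₁ x + f₂ x u

/-- `u` is a measurable control signal `[t,T) → U` and `ξ` is a state trajectory on `[t,T]` that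
starts from `x` at time `t` and evolves under `u`: it is the (absolutely continuous) solution of
`ξ' = f(ξ,u)`, written as an integral equation. -/
structure IsTrajectory {n m : ℕ}
    (f : EuclideanSpace ℝ (Fin n) → EuclideanSpace ℝ (Fin m) → EuclideanSpace ℝ (Fin n))
    (U : Set (EuclideanSpace ℝ (Fin m))) (T : ℝ) (x : EuclideanSpace ℝ (Fin n)) (t : ℝ)
    (u : ℝ → EuclideanSpace ℝ (Fin m)) (ξ : ℝ → EuclideanSpace ℝ (Fin n)) : Prop where
  measurable_control : Measurable u
  control_mem : ∀ τ ∈ Ico t T, u τ ∈ U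
  continuousOn : ContinuousOn ξ (Icc t T)
  integral_eq : ∀ τ ∈ Icc t T, ξ τ = x + ∫ s in t..τ, f (ξ s) (u s)

/-- `X` is a state space for the dynamics: for every control signal, the trajectory from a point
of `X` stays in `X` up to the final time. -/
def IsStateSpace {n m : ℕ}
    (f : EuclideanSpace ℝ (Fin n) → EuclideanSpace ℝ (Fin m) → EuclideanSpace ℝ (Fin n))
    (U : Set (EuclideanSpace ℝ (Fin m))) (T : ℝ) (X : Set (EuclideanSpace ℝ (Fin n))) : Prop :=
  ∀ x ∈ X, ∀ t ∈ Icc 0 T, ∀ u ξ, IsTrajectory f U T x t u ξ → ∀ τ ∈ Icc t T, ξ τ ∈ X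

/-- The safety value function `V_s(x,t) = sup_u min_{τ ∈ [t,T]} l(ξ(τ))`. -/
def safetyValue {n m : ℕ}
    (f : EuclideanSpace ℝ (Fin n) → EuclideanSpace ℝ (Fin m) → EuclideanSpace ℝ (Fin n))
    (U : Set (EuclideanSpace ℝ (Fin m))) (T : ℝ) (l : EuclideanSpace ℝ (Fin n) → ℝ)
    (x : EuclideanSpace ℝ (Fin n)) (t : ℝ) : ℝ :=
  sSup {c | ∃ u ξ, IsTrajectory f U T x t u ξ ∧ c = sInf ((fun τ => l (ξ τ)) '' Icc t T)}

/-- The maximal set of safe controls `U_s*(x,t)` for `t < T`: all `u ∈ U` for which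
`lim_{ε → 0+} V_s(ξ(t+ε), t+ε)` exists and is `≥ 0`, where `ξ` is the trajectory from `(x,t)`
under the constant control `u`. -/
def maxSafeControls {n m : ℕ}
    (f : EuclideanSpace ℝ (Fin n) → EuclideanSpace ℝ (Fin m) → EuclideanSpace ℝ (Fin n))
    (U : Set (EuclideanSpace ℝ (Fin m))) (T : ℝ) (l : EuclideanSpace ℝ (Fin n) → ℝ)
    (x : EuclideanSpace ℝ (Fin n)) (t : ℝ) : Set (EuclideanSpace ℝ (Fin m)) :=
  {u | u ∈ U ∧ ∃ ξ, IsTrajectory f U T x t (fun _ => u) ξ ∧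
    ∃ L : ℝ, 0 ≤ L ∧
      Tendsto (fun ε => safetyValue f U T l (ξ (t + ε)) (t + ε)) (𝓝[>] 0) (𝓝 L)}

/-- The value function of the control-constrained problem: the infimum of
`∫_t^T r(ξ,u) dτ + φ(ξ(T))` over the control signals with `u(τ) ∈ C(ξ(τ),τ)` for all
`τ ∈ [t,T)`. It is `⊤` when there is no such control signal. -/
def constrainedValue {n m : ℕ}
    (f : EuclideanSpace ℝ (Fin n) → EuclideanSpace ℝ (Fin m) → EuclideanSpace ℝ (Fin n))
    (U : Set (EuclideanSpace ℝ (Fin m))) (T : ℝ)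
    (r : EuclideanSpace ℝ (Fin n) → EuclideanSpace ℝ (Fin m) → ℝ)
    (φ : EuclideanSpace ℝ (Fin n) → ℝ)
    (C : EuclideanSpace ℝ (Fin n) → ℝ → Set (EuclideanSpace ℝ (Fin m)))
    (x : EuclideanSpace ℝ (Fin n)) (t : ℝ) : EReal :=
  sInf {c : EReal | ∃ u ξ, IsTrajectory f U T x t u ξ ∧ (∀ τ ∈ Ico t T, u τ ∈ C (ξ τ) τ) ∧
    c = (((∫ τ in t..T, r (ξ τ) (u τ)) + φ (ξ T) : ℝ) : EReal)}

/-- The Hamiltonian `inf_{u ∈ C(x,t)} { f(x,u) · p + r(x,u) }`, used only where `C(x,t)` is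
nonempty, `f` and `r` being bounded on it. -/
def hamiltonian {n m : ℕ}
    (f : EuclideanSpace ℝ (Fin n) → EuclideanSpace ℝ (Fin m) → EuclideanSpace ℝ (Fin n))
    (r : EuclideanSpace ℝ (Fin n) → EuclideanSpace ℝ (Fin m) → ℝ)
    (C : EuclideanSpace ℝ (Fin n) → ℝ → Set (EuclideanSpace ℝ (Fin m)))
    (x : EuclideanSpace ℝ (Fin n)) (t : ℝ) (p : EuclideanSpace ℝ (Fin n)) : ℝ :=
  sInf ((fun u => inner ℝ (f x u) p + r x u) '' C x t)

/-- The points of `X × [0,T]` at which the final-value problem is posed: all of `X × {T}`, and the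
points `(x,t)` with `t < T` at which the set `C(x,t)` of the minimisation is nonempty. It is all of
`X × [0,T]` when `C` has nonempty values. -/
def problemDomain {n m : ℕ} (X : Set (EuclideanSpace ℝ (Fin n))) (T : ℝ)
    (C : EuclideanSpace ℝ (Fin n) → ℝ → Set (EuclideanSpace ℝ (Fin m))) :
    Set (EuclideanSpace ℝ (Fin n) × ℝ) :=
  {p | p.1 ∈ X ∧ p.2 ∈ Icc 0 T ∧ (p.2 < T → (C p.1 p.2).Nonempty)}

/-- `V` is a viscosity solution of the final-value problem
`∂V/∂t + inf_{u ∈ C(x,t)} { f(x,u) · ∇ₓV + r(x,u) } = 0` for `t ∈ [0,T)`, `V(x,T) = φ(x)`. -/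
structure IsViscositySolution {n m : ℕ} (X : Set (EuclideanSpace ℝ (Fin n))) (T : ℝ)
    (f : EuclideanSpace ℝ (Fin n) → EuclideanSpace ℝ (Fin m) → EuclideanSpace ℝ (Fin n))
    (r : EuclideanSpace ℝ (Fin n) → EuclideanSpace ℝ (Fin m) → ℝ)
    (φ : EuclideanSpace ℝ (Fin n) → ℝ)
    (C : EuclideanSpace ℝ (Fin n) → ℝ → Set (EuclideanSpace ℝ (Fin m)))
    (V : EuclideanSpace ℝ (Fin n) → ℝ → EReal) : Prop where
  finite : ∀ p ∈ problemDomain X T C, V p.1 p.2 ≠ ⊤ ∧ V p.1 p.2 ≠ ⊥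
  bounded : ∃ M : ℝ, ∀ p ∈ problemDomain X T C, |(V p.1 p.2).toReal| ≤ M
  uniformContinuousOn :
    UniformContinuousOn (fun p : EuclideanSpace ℝ (Fin n) × ℝ => (V p.1 p.2).toReal)
      (problemDomain X T C)
  final : ∀ x ∈ X, V x T = (φ x : EReal)
  /-- The inequality at local maxima of `V - ψ`. -/
  of_localMax : ∀ x₀ ∈ X, ∀ t₀ ∈ Ico 0 T, (C x₀ t₀).Nonempty →
    ∀ ψ : EuclideanSpace ℝ (Fin n) × ℝ → ℝ, ContDiffAt ℝ 1 ψ (x₀, t₀) →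
      IsLocalMaxOn (fun p => V p.1 p.2 - (ψ p : EReal)) (X ×ˢ Icc 0 T) (x₀, t₀) →
      0 ≤ deriv (fun t => ψ (x₀, t)) t₀
        + hamiltonian f r C x₀ t₀ (gradient (fun x => ψ (x, t₀)) x₀)
  /-- The inequality at local minima of `V - ψ`. -/
  of_localMin : ∀ x₀ ∈ X, ∀ t₀ ∈ Ico 0 T, (C x₀ t₀).Nonempty →
    ∀ ψ : EuclideanSpace ℝ (Fin n) × ℝ → ℝ, ContDiffAt ℝ 1 ψ (x₀, t₀) →
      IsLocalMinOn (fun p => V p.1 p.2 - (ψ p : EReal)) (X ×ˢ Icc 0 T) (x₀, t₀) →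
      deriv (fun t => ψ (x₀, t)) t₀
        + hamiltonian f r C x₀ t₀ (gradient (fun x => ψ (x, t₀)) x₀) ≤ 0

end

/-! The safety value `V_s` is Lipschitz in `(x,t)`, because a trajectory from `(x,t)` is shadowed by
the trajectory of any nearby point that uses the same control. Being continuous along trajectories,
`V_s` decides safety on its own: `U_s*(x,t)` is all of `U` where `V_s ≥ 0` and empty elsewhere.
Hence, along a trajectory, the set of times at which `U_s*` is nonempty is closed; lower
hemicontinuity makes it open to the right, so a trajectory that starts with safe controls keeps all
of `U` as safe controls forever. On the domain of the problem the constraint is thus inactive, `V`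
is the unconstrained value function, and the rest is dynamic programming. -/

section IntervalIntegral

open MeasureTheory

variable {E : Type*} [NormedAddCommGroup E] [NormedSpace ℝ E] {a b : ℝ}

lemma norm_integral_le_integral_of_forall_Ioo (hab : a ≤ b) {g : ℝ → E} {c : ℝ → ℝ}
    (hc : IntervalIntegrable c volume a b) (h : ∀ s ∈ Ioo a b, ‖g s‖ ≤ c s) :
    ‖∫ s in a..b, g s‖ ≤ ∫ s in a..b, c s := by
  refine intervalIntegral.norm_integral_le_of_norm_le hab ?_ hc
  filter_upwards [volume.ae_ne b] with s hs hsab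
  exact h s ⟨hsab.1, lt_of_le_of_ne hsab.2 hs⟩

lemma norm_integral_le_mul_sub_of_forall_Ioo (hab : a ≤ b) {g : ℝ → E} {c : ℝ}
    (h : ∀ s ∈ Ioo a b, ‖g s‖ ≤ c) : ‖∫ s in a..b, g s‖ ≤ c * (b - a) := by
  refine (norm_integral_le_integral_of_forall_Ioo hab intervalIntegrable_const h).trans_eq ?_
  rw [intervalIntegral.integral_const, smul_eq_mul, mul_comm]

lemma continuousOn_integral_Icc (hab : a ≤ b) {g : ℝ → E}
    (hg : IntervalIntegrable g volume a b) :
    ContinuousOn (fun τ => ∫ s in a..τ, g s) (Icc a b) := by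
  rw [← uIcc_of_le hab]
  exact intervalIntegral.continuousOn_primitive_interval' hg left_mem_uIcc

lemma hasDerivWithinAt_integral_Ici [CompleteSpace E] {g : ℝ → E} (hg : ContinuousOn g (Icc a b))
    {τ : ℝ} (hτ : τ ∈ Ico a b) :
    HasDerivWithinAt (fun τ => ∫ s in a..τ, g s) (g τ) (Ici τ) τ := by
  have hmem : Icc a b ∈ 𝓝[>] τ :=
    mem_of_superset (Ioo_mem_nhdsGT hτ.2) fun s hs => ⟨hτ.1.trans hs.1.le, hs.2.le⟩
  refine intervalIntegral.integral_hasDerivWithinAt_right (t := Ioi τ)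
    ((hg.mono (Icc_subset_Icc_right hτ.2.le)).intervalIntegrable_of_Icc hτ.1)
    ⟨Icc a b, hmem, hg.aestronglyMeasurable measurableSet_Icc⟩ ?_
  exact (hg τ ⟨hτ.1, hτ.2.le⟩).mono_of_mem_nhdsWithin hmem

lemma le_mul_exp_of_le_add_integral {v : ℝ → ℝ} {δ K : ℝ} (hK : 0 ≤ K)
    (hv : ContinuousOn v (Icc a b)) (h : ∀ τ ∈ Icc a b, v τ ≤ δ + K * ∫ s in a..τ, v s)
    {τ : ℝ} (hτ : τ ∈ Icc a b) : v τ ≤ δ * Real.exp (K * (τ - a)) := by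
  have hab : a ≤ b := hτ.1.trans hτ.2
  have hbound : ∀ σ ∈ Ico a b, K * v σ ≤ K * (δ + K * ∫ s in a..σ, v s) + 0 := fun σ hσ => by
    rw [add_zero]
    exact mul_le_mul_of_nonneg_left (h σ ⟨hσ.1, hσ.2.le⟩) hK
  have hgronwall : δ + K * ∫ s in a..τ, v s ≤ gronwallBound δ K 0 (τ - a) :=
    le_gronwallBound_of_liminf_deriv_right_le
      (continuousOn_const.add
        (continuousOn_const.mul (continuousOn_integral_Icc hab (hv.intervalIntegrable_of_Icc hab))))
      (fun σ hσ _ hr =>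
        (((hasDerivWithinAt_integral_Ici hv hσ).const_mul K).const_add δ).liminf_right_slope_le hr)
      (by simp) hbound τ hτ
  rw [gronwallBound_ε0] at hgronwall
  exact (h τ hτ).trans hgronwall

lemma intervalIntegrable_comp_of_continuousOn {A B G : Type*}
    [NormedAddCommGroup G] [MeasurableSpace G] [BorelSpace G] [SecondCountableTopology G]
    [TopologicalSpace A] [MeasurableSpace A] [BorelSpace A] [SecondCountableTopology A]
    [TopologicalSpace B] [MeasurableSpace B] [BorelSpace B] [SecondCountableTopology B]
    {S : Set (A × B)} {g : A × B → G} (hg : ContinuousOn g S) {M : ℝ}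
    (hM : ∀ p ∈ S, ‖g p‖ ≤ M) (hab : a ≤ b) {ξ : ℝ → A} {u : ℝ → B}
    (hξ : ContinuousOn ξ (Icc a b)) (hu : Measurable u) (hS : ∀ s ∈ Ioo a b, (ξ s, u s) ∈ S) :
    IntervalIntegrable (fun s => g (ξ s, u s)) volume a b := by
  -- `S` need not be measurable: the integrand is measurable as a function on the subtype
  -- `Ioo a b`, where the composition factors through `S`.
  rw [intervalIntegrable_iff_integrableOn_Ioo_of_le hab]
  have hpair : Measurable (fun s : Ioo a b => (⟨(ξ s, u s), hS s s.2⟩ : S)) :=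
    ((hξ.mono Ioo_subset_Icc_self).domRestrict.measurable.prodMk
      (hu.comp measurable_subtype_coe)).subtype_mk
  have hmeas : AEStronglyMeasurable (fun s => g (ξ s, u s)) (volume.restrict (Ioo a b)) := by
    rw [← map_comap_subtype_coe measurableSet_Ioo,
      (MeasurableEmbedding.subtype_coe measurableSet_Ioo).aestronglyMeasurable_map_iff]
    exact (hg.domRestrict.measurable.comp hpair).aestronglyMeasurable
  exact Integrable.of_bound hmeas M
    ((ae_restrict_iff' measurableSet_Ioo).2 (.of_forall fun s hs => hM _ (hS s hs)))

end IntervalIntegral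

section Caratheodory

open MeasureTheory
open scoped NNReal

variable {E : Type*} [NormedAddCommGroup E] [NormedSpace ℝ E] {g : ℝ → E → E} {K : ℝ≥0}
  {t T : ℝ}

lemma norm_integral_sub_integral_le_of_lipschitzWith {c d τ : ℝ} (hc : 0 < c) (hd : 0 ≤ d)
    (hτ : t ≤ τ) (hg : ∀ s ∈ Ioo t τ, LipschitzWith K (g s)) {ζ ζ' : ℝ → E}
    (hζ : IntervalIntegrable (fun s => g s (ζ s)) volume t τ)
    (hζ' : IntervalIntegrable (fun s => g s (ζ' s)) volume t τ)
    (h : ∀ s ∈ Ioo t τ, ‖ζ s - ζ' s‖ ≤ d * Real.exp (c * s)) :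
    ‖(∫ s in t..τ, g s (ζ s)) - ∫ s in t..τ, g s (ζ' s)‖ ≤ K / c * d * Real.exp (c * τ) := by
  have hpointwise : ∀ s ∈ Ioo t τ, ‖g s (ζ s) - g s (ζ' s)‖ ≤ K * d * Real.exp (c * s) :=
    fun s hs => calc
      _ ≤ K * ‖ζ s - ζ' s‖ := (hg s hs).norm_sub_le _ _
      _ ≤ K * (d * Real.exp (c * s)) := by gcongr; exact h s hs
      _ = _ := (mul_assoc _ _ _).symm
  rw [← intervalIntegral.integral_sub hζ hζ']
  calc ‖∫ s in t..τ, (g s (ζ s) - g s (ζ' s))‖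
      ≤ ∫ s in t..τ, K * d * Real.exp (c * s) :=
        norm_integral_le_integral_of_forall_Ioo hτ
          (Continuous.intervalIntegrable (by fun_prop) _ _) hpointwise
    _ = K / c * d * (Real.exp (c * τ) - Real.exp (c * t)) := by
        rw [intervalIntegral.integral_const_mul, intervalIntegral.integral_comp_mul_left _ hc.ne',
          integral_exp, smul_eq_mul]
        ring
    _ ≤ K / c * d * Real.exp (c * τ) := by
        gcongr
        exact sub_le_self _ (Real.exp_pos _).le

lemma exists_isFixedPt_of_norm_sub_le_mul_weight [CompleteSpace E] {α : Type*}
    [TopologicalSpace α] [CompactSpace α] {w : C(α, ℝ)} (hw : ∀ s, 0 < w s) {k : ℝ≥0}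
    (hk : k < 1) {Φ : C(α, E) → C(α, E)}
    (hΦ : ∀ η η' d, 0 ≤ d → (∀ s, ‖η s - η' s‖ ≤ d * w s) →
      ∀ s, ‖Φ η s - Φ η' s‖ ≤ k * d * w s) :
    ∃ η, Function.IsFixedPt Φ η := by
  let w' : C(α, ℝ) := ⟨fun s => (w s)⁻¹, w.continuous.inv₀ fun s => (hw s).ne'⟩
  have hcontr : ContractingWith k fun η => w' • Φ (w • η) := by
    refine ⟨hk, LipschitzWith.of_dist_le_mul fun η η' =>
      (ContinuousMap.dist_le (by positivity)).2 fun s => ?_⟩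
    have hweighted : ∀ s, ‖(w • η) s - (w • η') s‖ ≤ dist η η' * w s := fun s => by
      rw [ContinuousMap.smul_apply', ContinuousMap.smul_apply', ← smul_sub, norm_smul,
        Real.norm_of_nonneg (hw s).le, mul_comm, ← dist_eq_norm]
      exact mul_le_mul_of_nonneg_right (ContinuousMap.dist_apply_le_dist s) (hw s).le
    rw [ContinuousMap.smul_apply', ContinuousMap.smul_apply', dist_eq_norm, ← smul_sub, norm_smul,
      ContinuousMap.coe_mk, Real.norm_of_nonneg (inv_pos.2 (hw s)).le, inv_mul_le_iff₀' (hw s)]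
    exact hΦ _ _ _ dist_nonneg hweighted s
  refine ⟨w • hcontr.fixedPoint, ?_⟩
  have hcancel : w • w' • Φ (w • hcontr.fixedPoint) = Φ (w • hcontr.fixedPoint) := by
    ext s
    exact smul_inv_smul₀ (hw s).ne' _
  exact hcancel.symm.trans (congrArg (w • ·) hcontr.fixedPoint_isFixedPt.eq)

theorem exists_forall_eq_add_integral_of_lipschitzWith [CompleteSpace E] (htT : t ≤ T)
    (hg : ∀ s ∈ Ioo t T, LipschitzWith K (g s))
    (hint : ∀ ζ : ℝ → E, Continuous ζ → IntervalIntegrable (fun s => g s (ζ s)) volume t T)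
    (x : E) :
    ∃ ξ : ℝ → E, Continuous ξ ∧ ∀ τ ∈ Icc t T, ξ τ = x + ∫ s in t..τ, g s (ξ s) := by
  let ext : C(Icc t T, E) → ℝ → E := fun η => IccExtend htT η
  have hext : ∀ η, IntervalIntegrable (fun s => g s (ext η s)) volume t T := fun η =>
    hint _ η.continuous.Icc_extend'
  let picard : C(Icc t T, E) → C(Icc t T, E) := fun η =>
    ⟨fun τ => x + ∫ s in t..τ, g s (ext η s),
      continuous_const.add (continuousOn_integral_Icc htT (hext η)).domRestrict⟩
  -- The weight makes the Picard operator a contraction on the whole interval at once.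
  let w : C(Icc t T, ℝ) := ⟨fun s => Real.exp ((K + 1 : ℝ≥0) * s), by fun_prop⟩
  have hcontr : ∀ η η' d, 0 ≤ d → (∀ s, ‖η s - η' s‖ ≤ d * w s) →
      ∀ τ, ‖picard η τ - picard η' τ‖ ≤ (K / (K + 1) : ℝ≥0) * d * w τ := by
    intro η η' d hd h τ
    have hsub : uIcc t (τ : ℝ) ⊆ uIcc t T := uIcc_subset_uIcc_left (Icc_subset_uIcc τ.2)
    rw [ContinuousMap.coe_mk, ContinuousMap.coe_mk, add_sub_add_left_eq_sub]
    refine norm_integral_sub_integral_le_of_lipschitzWith (by positivity) hd τ.2.1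
      (fun s hs => hg s ⟨hs.1, hs.2.trans_le τ.2.2⟩) ((hext η).mono_set hsub)
      ((hext η').mono_set hsub) fun s hs => ?_
    have hs' : s ∈ Icc t T := ⟨hs.1.le, hs.2.le.trans τ.2.2⟩
    simpa only [ext, w, IccExtend_of_mem htT _ hs', ContinuousMap.coe_mk] using h ⟨s, hs'⟩
  obtain ⟨η, hη⟩ := exists_isFixedPt_of_norm_sub_le_mul_weight (fun _ => Real.exp_pos _)
    ((div_lt_one (by positivity)).2 (lt_add_one K)) hcontr
  refine ⟨ext η, η.continuous.Icc_extend', fun τ hτ => ?_⟩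
  exact (IccExtend_of_mem htT _ hτ).trans (ContinuousMap.congr_fun hη ⟨τ, hτ⟩).symm

end Caratheodory

section BoundedLipschitz

open MeasureTheory
open scoped NNReal

/-- `g` is bounded by `M` and `K`-Lipschitz in both arguments jointly on `X × U`: the regularity
required of the dynamics and of the running cost. The dynamics have it with `X = univ`. -/
structure IsBoundedLipschitzOn {A B G : Type*} [PseudoMetricSpace A] [PseudoMetricSpace B]
    [SeminormedAddCommGroup G] (g : A → B → G) (X : Set A) (U : Set B) (M K : ℝ≥0) : Prop where
  norm_le : ∀ x ∈ X, ∀ w ∈ U, ‖g x w‖ ≤ M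
  lipschitzOnWith : LipschitzOnWith K (Function.uncurry g) (X ×ˢ U)

/-- A continuous state curve in `X` and a measurable control with values in `U` on `(a,b)`, not
necessarily linked by any dynamics. -/
structure IsAdmissibleOn {A B : Type*} [TopologicalSpace A] [MeasurableSpace B] (X : Set A)
    (U : Set B) (a b : ℝ) (ξ : ℝ → A) (u : ℝ → B) : Prop where
  continuousOn : ContinuousOn ξ (Icc a b)
  measurable : Measurable u
  mem : ∀ s ∈ Ioo a b, (ξ s, u s) ∈ X ×ˢ U

lemma IsAdmissibleOn.mono {A B : Type*} [TopologicalSpace A] [MeasurableSpace B] {X : Set A}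
    {U : Set B} {a b c d : ℝ} {ξ : ℝ → A} {u : ℝ → B} (h : IsAdmissibleOn X U a b ξ u)
    (hac : a ≤ c) (hdb : d ≤ b) : IsAdmissibleOn X U c d ξ u where
  continuousOn := h.continuousOn.mono (Icc_subset_Icc hac hdb)
  measurable := h.measurable
  mem τ hτ := h.mem τ (Ioo_subset_Ioo hac hdb hτ)

namespace IsBoundedLipschitzOn

lemma mono {A B G : Type*} [PseudoMetricSpace A] [PseudoMetricSpace B]
    [SeminormedAddCommGroup G] {g : A → B → G} {X Y : Set A} {U : Set B} {M K : ℝ≥0}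
    (hg : IsBoundedLipschitzOn g X U M K) (hYX : Y ⊆ X) : IsBoundedLipschitzOn g Y U M K where
  norm_le x hx := hg.norm_le x (hYX hx)
  lipschitzOnWith := hg.lipschitzOnWith.mono (prod_mono hYX subset_rfl)

lemma norm_sub_le {A B G : Type*} [SeminormedAddCommGroup A] [PseudoMetricSpace B]
    [SeminormedAddCommGroup G] {g : A → B → G} {X : Set A} {U : Set B} {M K : ℝ≥0}
    (hg : IsBoundedLipschitzOn g X U M K) {x y : A} (hx : x ∈ X) (hy : y ∈ X) {w : B}
    (hw : w ∈ U) : ‖g x w - g y w‖ ≤ K * ‖x - y‖ := by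
  simpa [Function.uncurry, dist_eq_norm, Prod.dist_eq] using
    hg.lipschitzOnWith.dist_le_mul (x, w) ⟨hx, hw⟩ (y, w) ⟨hy, hw⟩

lemma norm_integral_le {A B G : Type*} [PseudoMetricSpace A] [PseudoMetricSpace B]
    [MeasurableSpace B] [NormedAddCommGroup G] [NormedSpace ℝ G] {g : A → B → G} {X : Set A}
    {U : Set B} {M K : ℝ≥0} (hg : IsBoundedLipschitzOn g X U M K) {a b : ℝ} {ξ : ℝ → A}
    {u : ℝ → B} (h : IsAdmissibleOn X U a b ξ u) (hab : a ≤ b) :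
    ‖∫ s in a..b, g (ξ s) (u s)‖ ≤ M * (b - a) :=
  norm_integral_le_mul_sub_of_forall_Ioo hab fun s hs =>
    hg.norm_le _ (h.mem s hs).1 _ (h.mem s hs).2

section Integral

variable {A B G : Type*} [NormedAddCommGroup A] [MeasurableSpace A] [BorelSpace A]
  [SecondCountableTopology A] [PseudoMetricSpace B] [MeasurableSpace B] [BorelSpace B]
  [SecondCountableTopology B] [NormedAddCommGroup G]
  {g : A → B → G} {X : Set A} {U : Set B} {M K : ℝ≥0} {a b : ℝ} {ξ η : ℝ → A} {u : ℝ → B}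

lemma intervalIntegrable [MeasurableSpace G] [BorelSpace G] [SecondCountableTopology G]
    (hg : IsBoundedLipschitzOn g X U M K) (h : IsAdmissibleOn X U a b ξ u) (hab : a ≤ b) :
    IntervalIntegrable (fun s => g (ξ s) (u s)) volume a b :=
  intervalIntegrable_comp_of_continuousOn (g := Function.uncurry g)
    hg.lipschitzOnWith.continuousOn (fun p hp => hg.norm_le p.1 hp.1 p.2 hp.2) hab
    h.continuousOn h.measurable h.mem

lemma norm_integral_sub_integral_le [NormedSpace ℝ G] [MeasurableSpace G] [BorelSpace G]
    [SecondCountableTopology G] (hg : IsBoundedLipschitzOn g X U M K)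
    (hξ : IsAdmissibleOn X U a b ξ u) (hη : IsAdmissibleOn X U a b η u) (hab : a ≤ b) {δ : ℝ}
    (hδ : ∀ s ∈ Ioo a b, ‖ξ s - η s‖ ≤ δ) :
    ‖(∫ s in a..b, g (ξ s) (u s)) - ∫ s in a..b, g (η s) (u s)‖ ≤ K * δ * (b - a) := by
  rw [← intervalIntegral.integral_sub (hg.intervalIntegrable hξ hab)
    (hg.intervalIntegrable hη hab)]
  exact norm_integral_le_mul_sub_of_forall_Ioo hab fun s hs =>
    (hg.norm_sub_le (hξ.mem s hs).1 (hη.mem s hs).1 (hξ.mem s hs).2).trans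
      (mul_le_mul_of_nonneg_left (hδ s hs) K.2)

end Integral

end IsBoundedLipschitzOn

end BoundedLipschitz

section Trajectory

open MeasureTheory
open scoped NNReal

variable {n m : ℕ}
  {f : EuclideanSpace ℝ (Fin n) → EuclideanSpace ℝ (Fin m) → EuclideanSpace ℝ (Fin n)}
  {U : Set (EuclideanSpace ℝ (Fin m))} {T : ℝ} {X : Set (EuclideanSpace ℝ (Fin n))} {M K : ℝ≥0}
  {x y : EuclideanSpace ℝ (Fin n)} {t s : ℝ} {u v : ℝ → EuclideanSpace ℝ (Fin m)}
  {ξ η : ℝ → EuclideanSpace ℝ (Fin n)}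

lemma piecewise_Iio_of_lt {α : Type*} (g g' : ℝ → α) {s τ : ℝ} (h : τ < s) :
    (Iio s).piecewise g g' τ = g τ :=
  piecewise_eq_of_mem _ _ _ (mem_Iio.2 h)

lemma piecewise_Iio_of_le {α : Type*} (g g' : ℝ → α) {s τ : ℝ} (h : s ≤ τ) :
    (Iio s).piecewise g g' τ = g' τ :=
  piecewise_eq_of_notMem _ _ _ (notMem_Iio.2 h)

lemma exists_isTrajectory_of_control (hf : IsBoundedLipschitzOn f univ U M K)
    (hu : Measurable u) (htT : t ≤ T) (huU : ∀ τ ∈ Ico t T, u τ ∈ U)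
    (x : EuclideanSpace ℝ (Fin n)) : ∃ ξ, IsTrajectory f U T x t u ξ := by
  have huU' : ∀ s ∈ Ioo t T, u s ∈ U := fun s hs => huU s ⟨hs.1.le, hs.2⟩
  obtain ⟨ξ, hξ, hξ_eq⟩ := exists_forall_eq_add_integral_of_lipschitzWith
    (g := fun s y => f y (u s)) htT
    (fun s hs => LipschitzWith.of_dist_le_mul fun y z => by
      simpa only [dist_eq_norm] using hf.norm_sub_le (mem_univ y) (mem_univ z) (huU' s hs))
    (fun ζ hζ => hf.intervalIntegrable
      ⟨hζ.continuousOn, hu, fun s hs => ⟨mem_univ _, huU' s hs⟩⟩ htT) x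
  exact ⟨ξ, hu, huU, hξ.continuousOn, hξ_eq⟩

lemma exists_isTrajectory (hf : IsBoundedLipschitzOn f univ U M K) (htT : t ≤ T)
    (hU : t < T → U.Nonempty) (x : EuclideanSpace ℝ (Fin n)) :
    ∃ u ξ, IsTrajectory f U T x t u ξ := by
  obtain ⟨w, hw⟩ : ∃ w, t < T → w ∈ U :=
    ⟨Classical.epsilon (· ∈ U), fun h => Classical.epsilon_spec (hU h)⟩
  exact ⟨fun _ => w, exists_isTrajectory_of_control hf measurable_const htT
    (fun τ hτ => hw (hτ.1.trans_lt hτ.2)) x⟩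

namespace IsTrajectory

lemma apply_left (h : IsTrajectory f U T x t u ξ) (htT : t ≤ T) : ξ t = x := by
  simpa using h.integral_eq t ⟨le_rfl, htT⟩

lemma isAdmissibleOn (h : IsTrajectory f U T x t u ξ) (hξX : ∀ τ ∈ Icc t T, ξ τ ∈ X) {a b : ℝ}
    (ha : t ≤ a) (hb : b ≤ T) : IsAdmissibleOn X U a b ξ u where
  continuousOn := h.continuousOn.mono (Icc_subset_Icc ha hb)
  measurable := h.measurable_control
  mem τ hτ := ⟨hξX τ ⟨ha.trans hτ.1.le, hτ.2.le.trans hb⟩,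
    h.control_mem τ ⟨ha.trans hτ.1.le, hτ.2.trans_le hb⟩⟩

lemma isAdmissibleOn_univ (h : IsTrajectory f U T x t u ξ) {a b : ℝ} (ha : t ≤ a) (hb : b ≤ T) :
    IsAdmissibleOn univ U a b ξ u :=
  h.isAdmissibleOn (fun _ _ => mem_univ _) ha hb

lemma sub_eq_integral (h : IsTrajectory f U T x t u ξ) (hf : IsBoundedLipschitzOn f univ U M K)
    {a b : ℝ} (ha : t ≤ a) (hab : a ≤ b) (hb : b ≤ T) :
    ξ b - ξ a = ∫ τ in a..b, f (ξ τ) (u τ) := by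
  rw [h.integral_eq b ⟨ha.trans hab, hb⟩, h.integral_eq a ⟨ha, hab.trans hb⟩,
    ← intervalIntegral.integral_add_adjacent_intervals
      (hf.intervalIntegrable (h.isAdmissibleOn_univ le_rfl (hab.trans hb)) ha)
      (hf.intervalIntegrable (h.isAdmissibleOn_univ ha hb) hab)]
  abel

lemma norm_sub_le (h : IsTrajectory f U T x t u ξ) (hf : IsBoundedLipschitzOn f univ U M K)
    {τ : ℝ} (hτ : τ ∈ Icc t T) : ‖ξ τ - x‖ ≤ M * (τ - t) := by
  rw [← h.apply_left (hτ.1.trans hτ.2), h.sub_eq_integral hf le_rfl hτ.1 hτ.2]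
  exact hf.norm_integral_le (h.isAdmissibleOn_univ le_rfl hτ.2) hτ.1

lemma restrict (h : IsTrajectory f U T x t u ξ) (hf : IsBoundedLipschitzOn f univ U M K)
    (hts : t ≤ s) : IsTrajectory f U T (ξ s) s u ξ where
  measurable_control := h.measurable_control
  control_mem τ hτ := h.control_mem τ ⟨hts.trans hτ.1, hτ.2⟩
  continuousOn := h.continuousOn.mono (Icc_subset_Icc_left hts)
  integral_eq τ hτ := by
    rw [← h.sub_eq_integral hf hts hτ.1 hτ.2, add_sub_cancel]

lemma congr_control (h : IsTrajectory f U T x t u ξ) (hv : Measurable v)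
    (huv : EqOn u v (Ico t T)) : IsTrajectory f U T x t v ξ where
  measurable_control := hv
  control_mem τ hτ := huv hτ ▸ h.control_mem τ hτ
  continuousOn := h.continuousOn
  integral_eq τ hτ := by
    rw [h.integral_eq τ hτ, intervalIntegral.integral_congr_Ioo_of_le hτ.1 fun σ hσ => by
      rw [huv ⟨hσ.1.le, hσ.2.trans_le hτ.2⟩]]

lemma piecewise_Iio_of_ge (h : IsTrajectory f U T (ξ s) s v η) (hs : s ≤ T) {τ : ℝ}
    (hτ : τ ≤ s) : (Iio s).piecewise ξ η τ = ξ τ := by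
  rcases hτ.lt_or_eq with hτs | rfl
  · exact piecewise_Iio_of_lt _ _ hτs
  · rw [piecewise_Iio_of_le _ _ le_rfl, h.apply_left hs]

lemma piecewise_control_mem (h : IsTrajectory f U T x t u ξ) (h' : IsTrajectory f U T y s v η)
    {τ : ℝ} (hτ : τ ∈ Ico t T) : (Iio s).piecewise u v τ ∈ U := by
  rcases lt_or_ge τ s with hτs | hτs
  · rw [piecewise_Iio_of_lt _ _ hτs]
    exact h.control_mem τ hτ
  · rw [piecewise_Iio_of_le _ _ hτs]
    exact h'.control_mem τ ⟨hτs, hτ.2⟩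

lemma isAdmissibleOn_concat (h : IsTrajectory f U T x t u ξ)
    (h' : IsTrajectory f U T (ξ s) s v η) (hs : s ∈ Icc t T) :
    IsAdmissibleOn univ U t T ((Iio s).piecewise ξ η) ((Iio s).piecewise u v) where
  continuousOn := by
    rw [← Icc_union_Icc_eq_Icc hs.1 hs.2]
    exact ((h.continuousOn.mono (Icc_subset_Icc_right hs.2)).congr
        fun τ hτ => h'.piecewise_Iio_of_ge hs.2 hτ.2).union_of_isClosed
      (h'.continuousOn.congr fun τ hτ => piecewise_Iio_of_le _ _ hτ.1) isClosed_Icc isClosed_Icc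
  measurable := h.measurable_control.piecewise measurableSet_Iio h'.measurable_control
  mem _ hτ := ⟨mem_univ _, h.piecewise_control_mem h' ⟨hτ.1.le, hτ.2⟩⟩

lemma concat (h : IsTrajectory f U T x t u ξ) (h' : IsTrajectory f U T (ξ s) s v η)
    (hf : IsBoundedLipschitzOn f univ U M K) (hs : s ∈ Icc t T) :
    IsTrajectory f U T x t ((Iio s).piecewise u v) ((Iio s).piecewise ξ η) where
  measurable_control := (h.isAdmissibleOn_concat h' hs).measurable
  control_mem _ hτ := h.piecewise_control_mem h' hτ
  continuousOn := (h.isAdmissibleOn_concat h' hs).continuousOn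
  integral_eq τ hτ := by
    let F : ℝ → EuclideanSpace ℝ (Fin n) := fun σ =>
      f ((Iio s).piecewise ξ η σ) ((Iio s).piecewise u v σ)
    have hbefore : ∀ σ, σ ≤ s → t ≤ σ → ∫ σ' in t..σ, F σ' = ξ σ - x := fun σ hσ htσ => by
      rw [h.integral_eq σ ⟨htσ, hσ.trans hs.2⟩, add_sub_cancel_left]
      refine intervalIntegral.integral_congr_Ioo_of_le htσ fun σ' hσ' => ?_
      have hlt : σ' < s := hσ'.2.trans_le hσ
      simp only [F, piecewise_Iio_of_lt _ _ hlt]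
    rcases le_total τ s with hτs | hsτ
    · rw [h'.piecewise_Iio_of_ge hs.2 hτs, hbefore τ hτs hτ.1, add_sub_cancel]
    have hafter : ∫ σ in s..τ, F σ = η τ - ξ s := by
      rw [h'.integral_eq τ ⟨hsτ, hτ.2⟩, add_sub_cancel_left]
      refine intervalIntegral.integral_congr_Ioo_of_le hsτ fun σ hσ => ?_
      simp only [F, piecewise_Iio_of_le _ _ hσ.1.le]
    have hF : IntervalIntegrable F volume t T :=
      hf.intervalIntegrable (h.isAdmissibleOn_concat h' hs) (hs.1.trans hs.2)
    rw [piecewise_Iio_of_le _ _ hsτ, ← intervalIntegral.integral_add_adjacent_intervals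
      (hF.mono_set (uIcc_subset_uIcc_left (Icc_subset_uIcc hs)))
      (hF.mono_set (uIcc_subset_uIcc (Icc_subset_uIcc hs) (Icc_subset_uIcc hτ))),
      hbefore s le_rfl hs.1, hafter]
    abel

lemma norm_sub_le_mul_exp (h : IsTrajectory f U T x t u ξ) (h' : IsTrajectory f U T y t u η)
    (hf : IsBoundedLipschitzOn f univ U M K) {τ : ℝ} (hτ : τ ∈ Icc t T) :
    ‖ξ τ - η τ‖ ≤ ‖x - y‖ * Real.exp (K * (τ - t)) := by
  have hdiff : ContinuousOn (fun σ => ‖ξ σ - η σ‖) (Icc t T) :=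
    (h.continuousOn.sub h'.continuousOn).norm
  refine le_mul_exp_of_le_add_integral K.2 hdiff (fun σ hσ => ?_) hτ
  have hadm := h.isAdmissibleOn_univ le_rfl hσ.2
  have hadm' := h'.isAdmissibleOn_univ le_rfl hσ.2
  rw [h.integral_eq σ hσ, h'.integral_eq σ hσ, add_sub_add_comm,
    ← intervalIntegral.integral_sub (hf.intervalIntegrable hadm hσ.1)
      (hf.intervalIntegrable hadm' hσ.1), ← intervalIntegral.integral_const_mul]
  refine norm_add_le_of_le le_rfl (norm_integral_le_integral_of_forall_Ioo hσ.1
    (((hdiff.mono (Icc_subset_Icc_right hσ.2)).intervalIntegrable_of_Icc hσ.1).const_mul _)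
    fun ρ hρ => ?_)
  exact hf.norm_sub_le (mem_univ _) (mem_univ _) (hadm.mem ρ hρ).2

lemma norm_apply_sub_apply_le (h : IsTrajectory f U T x t u ξ) (h' : IsTrajectory f U T y s v η)
    (hf : IsBoundedLipschitzOn f univ U M K) {σ τ : ℝ} (hσ : σ ∈ Icc t T) (hτ : τ ∈ Icc s T)
    (hστ : (σ - t) + (τ - s) ≤ |t - s|) : ‖ξ σ - η τ‖ ≤ (1 + M) * dist (x, t) (y, s) := by
  have hx : ‖x - y‖ ≤ dist (x, t) (y, s) := dist_eq_norm x y ▸ le_max_left _ _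
  have ht : |t - s| ≤ dist (x, t) (y, s) := le_max_right _ _
  calc ‖ξ σ - η τ‖
      = ‖(x - y) + (ξ σ - x) - (η τ - y)‖ := by congr 1; abel
    _ ≤ ‖x - y‖ + ‖ξ σ - x‖ + ‖η τ - y‖ := norm_sub_le_of_le (norm_add_le _ _) le_rfl
    _ ≤ dist (x, t) (y, s) + M * (σ - t) + M * (τ - s) := by
        gcongr
        exacts [h.norm_sub_le hf hσ, h'.norm_sub_le hf hτ]
    _ = dist (x, t) (y, s) + M * ((σ - t) + (τ - s)) := by ring
    _ ≤ dist (x, t) (y, s) + M * dist (x, t) (y, s) := by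
        gcongr
        exact hστ.trans ht
    _ = _ := by ring

lemma norm_apply_max_sub_le (h : IsTrajectory f U T x t u ξ) (h' : IsTrajectory f U T y s v η)
    (hf : IsBoundedLipschitzOn f univ U M K) (ht : t ∈ Icc 0 T) (hs : s ∈ Icc 0 T)
    (huv : EqOn u v (Ici t)) {τ : ℝ} (hτ : τ ∈ Icc s T) :
    ‖ξ (max τ t) - η τ‖ ≤ (1 + M) * dist (x, t) (y, s) * Real.exp (K * T) := by
  -- The two trajectories are compared at the times `τ ≥ t` at which both run; before `t`, the
  -- second one is compared with the starting point of the first.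
  rcases le_total t τ with htτ | hτt
  · have hstart : ‖ξ (max s t) - η (max s t)‖ ≤ (1 + M) * dist (x, t) (y, s) :=
      h.norm_apply_sub_apply_le h' hf ⟨le_max_right _ _, max_le hs.2 ht.2⟩
        ⟨le_max_left _ _, max_le hs.2 ht.2⟩
        (by linarith [max_sub_min_eq_abs s t, min_add_max s t])
    have hξ := (h.restrict hf (le_max_right s t)).congr_control h'.measurable_control
      fun σ hσ => huv ((le_max_right s t).trans hσ.1)
    rw [max_eq_left htτ]
    refine (hξ.norm_sub_le_mul_exp (h'.restrict hf (le_max_left s t)) hf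
      ⟨max_le hτ.1 htτ, hτ.2⟩).trans ?_
    gcongr
    linarith [hτ.2, hs.1.trans (le_max_left s t)]
  · rw [max_eq_right hτt]
    refine (h.norm_apply_sub_apply_le h' hf ⟨le_rfl, ht.2⟩ hτ ?_).trans
      (le_mul_of_one_le_right (by positivity) (Real.one_le_exp ?_))
    · linarith [le_abs_self (t - s)]
    · exact mul_nonneg K.2 (ht.1.trans ht.2)

end IsTrajectory

lemma exists_isTrajectory_shadow (h : IsTrajectory f U T x t u ξ)
    (hf : IsBoundedLipschitzOn f univ U M K) (ht : t ∈ Icc 0 T)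
    (hs : s ∈ Icc 0 T) (hU : s < T → U.Nonempty) (y : EuclideanSpace ℝ (Fin n)) :
    ∃ v η, IsTrajectory f U T y s v η ∧ EqOn u v (Ici t) ∧ ∀ τ ∈ Icc s T,
      ‖ξ (max τ t) - η τ‖ ≤ (1 + M) * dist (x, t) (y, s) * Real.exp (K * T) := by
  obtain ⟨w, hw⟩ : ∃ w, s < T → w ∈ U :=
    ⟨Classical.epsilon (· ∈ U), fun h => Classical.epsilon_spec (hU h)⟩
  have hwu : EqOn u ((Iio t).piecewise (fun _ => w) u) (Ici t) := fun τ hτ =>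
    (piecewise_Iio_of_le _ _ hτ).symm
  obtain ⟨η, hη⟩ := exists_isTrajectory_of_control (u := (Iio t).piecewise (fun _ => w) u) hf
    (measurable_const.piecewise measurableSet_Iio h.measurable_control) hs.2 (fun τ hτ => by
      rcases lt_or_ge τ t with hτt | htτ
      · rw [piecewise_Iio_of_lt _ _ hτt]
        exact hw (hτ.1.trans_lt hτ.2)
      · rw [piecewise_Iio_of_le _ _ htτ]
        exact h.control_mem τ ⟨htτ, hτ.2⟩) y
  exact ⟨_, η, hη, hwu, fun τ hτ => h.norm_apply_max_sub_le hη hf ht hs hwu hτ⟩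

end Trajectory

section Domain

variable {n m : ℕ}
  {f : EuclideanSpace ℝ (Fin n) → EuclideanSpace ℝ (Fin m) → EuclideanSpace ℝ (Fin n)}
  {U : Set (EuclideanSpace ℝ (Fin m))} {T : ℝ} {X : Set (EuclideanSpace ℝ (Fin n))}
  {C : EuclideanSpace ℝ (Fin n) → ℝ → Set (EuclideanSpace ℝ (Fin m))}
  {x : EuclideanSpace ℝ (Fin n)} {t : ℝ} {u : ℝ → EuclideanSpace ℝ (Fin m)}
  {ξ : ℝ → EuclideanSpace ℝ (Fin n)}

lemma problemDomain_subset_prod_Icc : problemDomain X T C ⊆ X ×ˢ Icc 0 T :=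
  fun _ hp => ⟨hp.1, hp.2.1⟩

lemma IsTrajectory.mem_problemDomain (h : IsTrajectory f U T x t u ξ)
    (hX : IsStateSpace f U T X) (hx : x ∈ X) (ht : t ∈ Icc 0 T) {τ : ℝ} (hτ : τ ∈ Icc t T) :
    (ξ τ, τ) ∈ problemDomain X T (fun _ _ => U) :=
  ⟨hX x hx t ht u ξ h τ hτ, ⟨ht.1.trans hτ.1, hτ.2⟩,
    fun hτT => ⟨u τ, h.control_mem τ ⟨hτ.1, hτT⟩⟩⟩

end Domain

section Safety

open scoped NNReal

variable {n m : ℕ}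
  {f : EuclideanSpace ℝ (Fin n) → EuclideanSpace ℝ (Fin m) → EuclideanSpace ℝ (Fin n)}
  {U : Set (EuclideanSpace ℝ (Fin m))} {T : ℝ} {X : Set (EuclideanSpace ℝ (Fin n))}
  {M K Kl : ℝ≥0} {l : EuclideanSpace ℝ (Fin n) → ℝ} {x y : EuclideanSpace ℝ (Fin n)} {t s : ℝ}
  {u : ℝ → EuclideanSpace ℝ (Fin m)} {ξ : ℝ → EuclideanSpace ℝ (Fin n)}

lemma IsTrajectory.bddBelow_image_comp (h : IsTrajectory f U T x t u ξ)
    (hξX : ∀ τ ∈ Icc t T, ξ τ ∈ X) (hl : ContinuousOn l X) :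
    BddBelow ((fun τ => l (ξ τ)) '' Icc t T) :=
  (isCompact_Icc.image_of_continuousOn (hl.comp h.continuousOn hξX)).bddBelow

lemma IsTrajectory.sInf_le_safetyValue (h : IsTrajectory f U T x t u ξ)
    (hX : IsStateSpace f U T X) (hl : ContinuousOn l X) (hx : x ∈ X) (ht : t ∈ Icc 0 T) :
    sInf ((fun τ => l (ξ τ)) '' Icc t T) ≤ safetyValue f U T l x t := by
  refine le_csSup ⟨l x, ?_⟩ ⟨u, ξ, h, rfl⟩
  rintro _ ⟨v, η, hη, rfl⟩
  exact csInf_le (hη.bddBelow_image_comp (hX x hx t ht v η hη) hl)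
    ⟨t, ⟨le_rfl, ht.2⟩, congrArg l (hη.apply_left ht.2)⟩

lemma safetyValue_le_add (hf : IsBoundedLipschitzOn f univ U M K) (hX : IsStateSpace f U T X)
    (hl : LipschitzOnWith Kl l X) (hxt : (x, t) ∈ problemDomain X T (fun _ _ => U))
    (hys : (y, s) ∈ problemDomain X T (fun _ _ => U)) :
    safetyValue f U T l x t ≤
      safetyValue f U T l y s + Kl * (1 + M) * Real.exp (K * T) * dist (x, t) (y, s) := by
  obtain ⟨hx, ht, hUt⟩ := hxt
  obtain ⟨hy, hs, hUs⟩ := hys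
  obtain ⟨u₀, ξ₀, h₀⟩ := exists_isTrajectory hf ht.2 hUt x
  refine csSup_le ⟨_, u₀, ξ₀, h₀, rfl⟩ ?_
  rintro _ ⟨u, ξ, h, rfl⟩
  obtain ⟨v, η, hη, -, hshadow⟩ := exists_isTrajectory_shadow h hf ht hs hUs y
  rw [← sub_le_iff_le_add]
  refine (le_csInf ((nonempty_Icc.2 hs.2).image _) ?_).trans
    (hη.sInf_le_safetyValue hX hl.continuousOn hy hs)
  rintro _ ⟨τ, hτ, rfl⟩
  have hmem : max τ t ∈ Icc t T := ⟨le_max_right _ _, max_le hτ.2 ht.2⟩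
  have hξX := hX x hx t ht u ξ h
  have hmin : sInf ((fun τ => l (ξ τ)) '' Icc t T) ≤ l (ξ (max τ t)) :=
    csInf_le (h.bddBelow_image_comp hξX hl.continuousOn) (mem_image_of_mem _ hmem)
  have hnear : l (ξ (max τ t)) - l (η τ) ≤
      Kl * ((1 + M) * dist (x, t) (y, s) * Real.exp (K * T)) := calc
    _ ≤ Kl * ‖ξ (max τ t) - η τ‖ :=
        (le_abs_self _).trans (hl.norm_sub_le (hξX _ hmem) (hX y hy s hs v η hη τ hτ))
    _ ≤ Kl * ((1 + M) * dist (x, t) (y, s) * Real.exp (K * T)) := by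
        gcongr
        exact hshadow τ hτ
  linarith

lemma continuousOn_safetyValue (hf : IsBoundedLipschitzOn f univ U M K)
    (hX : IsStateSpace f U T X) (hl : LipschitzOnWith Kl l X) :
    ContinuousOn (fun p : EuclideanSpace ℝ (Fin n) × ℝ => safetyValue f U T l p.1 p.2)
      (problemDomain X T (fun _ _ => U)) :=
  (LipschitzOnWith.of_le_add_mul' _ fun _ hp _ hq =>
    safetyValue_le_add hf hX hl hp hq).continuousOn

lemma IsTrajectory.continuousOn_safetyValue (h : IsTrajectory f U T x t u ξ)
    (hf : IsBoundedLipschitzOn f univ U M K) (hX : IsStateSpace f U T X)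
    (hl : LipschitzOnWith Kl l X) (hx : x ∈ X) (ht : t ∈ Icc 0 T) :
    ContinuousOn (fun τ => safetyValue f U T l (ξ τ) τ) (Icc t T) :=
  (_root_.continuousOn_safetyValue hf hX hl).comp (h.continuousOn.prodMk continuousOn_id)
    fun _ hτ => h.mem_problemDomain hX hx ht hτ

lemma tendsto_const_add_nhdsGT_zero (ht : t < T) :
    Tendsto (fun ε => t + ε) (𝓝[>] 0) (𝓝[Icc t T] t) := by
  refine tendsto_nhdsWithin_iff.2 ⟨?_, ?_⟩
  · exact (Continuous.tendsto' (by fun_prop) 0 t (add_zero t)).mono_left nhdsWithin_le_nhds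
  · filter_upwards [Ioo_mem_nhdsGT (sub_pos.2 ht)] with ε hε
    exact ⟨by linarith [hε.1], by linarith [hε.2]⟩

lemma IsTrajectory.tendsto_safetyValue (h : IsTrajectory f U T x t u ξ)
    (hf : IsBoundedLipschitzOn f univ U M K) (hX : IsStateSpace f U T X)
    (hl : LipschitzOnWith Kl l X) (hx : x ∈ X) (ht : t ∈ Ico 0 T) :
    Tendsto (fun ε => safetyValue f U T l (ξ (t + ε)) (t + ε)) (𝓝[>] 0)
      (𝓝 (safetyValue f U T l x t)) := by
  have hcont := h.continuousOn_safetyValue hf hX hl hx (Ico_subset_Icc_self ht) t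
    ⟨le_rfl, ht.2.le⟩
  rw [ContinuousWithinAt, h.apply_left ht.2.le] at hcont
  exact hcont.comp (tendsto_const_add_nhdsGT_zero ht.2)

lemma mem_maxSafeControls_iff (hf : IsBoundedLipschitzOn f univ U M K)
    (hX : IsStateSpace f U T X) (hl : LipschitzOnWith Kl l X) (hx : x ∈ X) (ht : t ∈ Ico 0 T)
    {w : EuclideanSpace ℝ (Fin m)} :
    w ∈ maxSafeControls f U T l x t ↔ w ∈ U ∧ 0 ≤ safetyValue f U T l x t := by
  constructor
  · rintro ⟨hw, ξ, h, L, hL, hlim⟩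
    exact ⟨hw, tendsto_nhds_unique hlim (h.tendsto_safetyValue hf hX hl hx ht) ▸ hL⟩
  · rintro ⟨hw, hsafe⟩
    obtain ⟨ξ, h⟩ := exists_isTrajectory_of_control hf measurable_const ht.2.le
      (fun _ _ => hw) x
    exact ⟨hw, ξ, h, _, hsafe, h.tendsto_safetyValue hf hX hl hx ht⟩

lemma maxSafeControls_nonempty_iff (hf : IsBoundedLipschitzOn f univ U M K)
    (hX : IsStateSpace f U T X) (hl : LipschitzOnWith Kl l X) (hx : x ∈ X) (ht : t ∈ Ico 0 T) :
    (maxSafeControls f U T l x t).Nonempty ↔ U.Nonempty ∧ 0 ≤ safetyValue f U T l x t := by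
  simp only [Set.Nonempty, mem_maxSafeControls_iff hf hX hl hx ht, exists_and_right]

lemma maxSafeControls_eq_of_nonempty (hf : IsBoundedLipschitzOn f univ U M K)
    (hX : IsStateSpace f U T X) (hl : LipschitzOnWith Kl l X) (hx : x ∈ X) (ht : t ∈ Ico 0 T)
    (hne : (maxSafeControls f U T l x t).Nonempty) : maxSafeControls f U T l x t = U := by
  ext w
  rw [mem_maxSafeControls_iff hf hX hl hx ht]
  exact and_iff_left ((maxSafeControls_nonempty_iff hf hX hl hx ht).1 hne).2

lemma IsTrajectory.eventually_nonempty (h : IsTrajectory f U T x t u ξ)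
    (hX : IsStateSpace f U T X) (hx : x ∈ X) (ht : t ∈ Icc 0 T)
    {C : EuclideanSpace ℝ (Fin n) → ℝ → Set (EuclideanSpace ℝ (Fin m))}
    (hC : LowerHemicontinuousOn (fun p : EuclideanSpace ℝ (Fin n) × ℝ => C p.1 p.2)
      (X ×ˢ Ico 0 T)) {σ : ℝ} (hσ : σ ∈ Ico t T) (hne : (C (ξ σ) σ).Nonempty) :
    ∀ᶠ ρ in 𝓝[>] σ, (C (ξ ρ) ρ).Nonempty := by
  have hmem : ∀ ρ ∈ Ico t T, (ξ ρ, ρ) ∈ X ×ˢ Ico 0 T := fun ρ hρ =>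
    ⟨hX x hx t ht u ξ h ρ (Ico_subset_Icc_self hρ), ht.1.trans hρ.1, hρ.2⟩
  have hnear : ∀ᶠ p in 𝓝[X ×ˢ Ico 0 T] (ξ σ, σ), (C p.1 p.2 ∩ univ).Nonempty :=
    lowerHemicontinuousWithinAt_iff.1 (hC _ (hmem σ hσ)) univ isOpen_univ (by simpa using hne)
  have htendsto : Tendsto (fun ρ => (ξ ρ, ρ)) (𝓝[Ico t T] σ) (𝓝[X ×ˢ Ico 0 T] (ξ σ, σ)) :=
    (((h.continuousOn.mono Ico_subset_Icc_self).prodMk continuousOn_id) σ hσ).tendsto_nhdsWithin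
      hmem
  have hIco : Ico t T ∈ 𝓝[>] σ :=
    mem_of_superset (Ioo_mem_nhdsGT hσ.2) fun ρ hρ => ⟨hσ.1.trans hρ.1.le, hρ.2⟩
  simpa only [inter_univ] using
    (htendsto.eventually hnear).filter_mono (nhdsWithin_le_of_mem hIco)

lemma IsTrajectory.maxSafeControls_nonempty (h : IsTrajectory f U T x t u ξ)
    (hf : IsBoundedLipschitzOn f univ U M K) (hX : IsStateSpace f U T X)
    (hl : LipschitzOnWith Kl l X)
    (hlhc : LowerHemicontinuousOn (fun p : EuclideanSpace ℝ (Fin n) × ℝ =>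
      maxSafeControls f U T l p.1 p.2) (X ×ˢ Ico 0 T))
    (hx : x ∈ X) (ht : t ∈ Icc 0 T) (hne : (maxSafeControls f U T l x t).Nonempty)
    {τ : ℝ} (hτ : τ ∈ Ico t T) : (maxSafeControls f U T l (ξ τ) τ).Nonempty := by
  have htT : t < T := hτ.1.trans_lt hτ.2
  have hU : U.Nonempty := hne.mono fun _ hw => hw.1
  have hiff : ∀ σ ∈ Icc t τ, (maxSafeControls f U T l (ξ σ) σ).Nonempty ↔
      0 ≤ safetyValue f U T l (ξ σ) σ := fun σ hσ => by
    rw [maxSafeControls_nonempty_iff hf hX hl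
      (hX x hx t ht u ξ h σ ⟨hσ.1, hσ.2.trans hτ.2.le⟩)
      ⟨ht.1.trans hσ.1, hσ.2.trans_lt hτ.2⟩, and_iff_right hU]
  have hclosed : IsClosed ({σ | (maxSafeControls f U T l (ξ σ) σ).Nonempty} ∩ Icc t τ) := by
    rw [inter_comm, show Icc t τ ∩ {σ | (maxSafeControls f U T l (ξ σ) σ).Nonempty} =
      Icc t τ ∩ {σ | 0 ≤ safetyValue f U T l (ξ σ) σ} from Set.ext fun σ =>
        and_congr_right (hiff σ)]
    exact ((h.continuousOn_safetyValue hf hX hl hx ht).mono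
      (Icc_subset_Icc_right hτ.2.le)).preimage_isClosed_of_isClosed isClosed_Icc isClosed_Ici
  refine hclosed.Icc_subset_of_forall_mem_nhdsWithin ?_ (fun σ hσ => ?_) ⟨hτ.1, le_rfl⟩
  · rwa [mem_ofPred_eq, h.apply_left htT.le]
  · exact h.eventually_nonempty hX hx ht hlhc ⟨hσ.2.1, hσ.2.2.trans hτ.2⟩ hσ.1

end Safety

section InactiveConstraint

open scoped NNReal

variable {n m : ℕ}

/-- The control constraint `u(τ) ∈ C(ξ(τ),τ)` never restricts the trajectories that start where it
can be met: `C` is all of `U` wherever it is nonempty, and it remains nonempty along every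
trajectory. -/
structure IsInactiveConstraint
    (f : EuclideanSpace ℝ (Fin n) → EuclideanSpace ℝ (Fin m) → EuclideanSpace ℝ (Fin n))
    (U : Set (EuclideanSpace ℝ (Fin m))) (T : ℝ) (X : Set (EuclideanSpace ℝ (Fin n)))
    (C : EuclideanSpace ℝ (Fin n) → ℝ → Set (EuclideanSpace ℝ (Fin m))) : Prop where
  eq_of_nonempty : ∀ x ∈ X, ∀ t ∈ Ico 0 T, (C x t).Nonempty → C x t = U
  nonempty_of_isTrajectory : ∀ x ∈ X, ∀ t ∈ Icc 0 T, (C x t).Nonempty →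
    ∀ u ξ, IsTrajectory f U T x t u ξ → ∀ τ ∈ Ico t T, (C (ξ τ) τ).Nonempty

variable {f : EuclideanSpace ℝ (Fin n) → EuclideanSpace ℝ (Fin m) → EuclideanSpace ℝ (Fin n)}
  {U : Set (EuclideanSpace ℝ (Fin m))} {T : ℝ} {X : Set (EuclideanSpace ℝ (Fin n))}

theorem isInactiveConstraint_maxSafeControls {M K Kl : ℝ≥0} {l : EuclideanSpace ℝ (Fin n) → ℝ}
    (hf : IsBoundedLipschitzOn f univ U M K) (hX : IsStateSpace f U T X)
    (hl : LipschitzOnWith Kl l X)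
    (hlhc : LowerHemicontinuousOn (fun p : EuclideanSpace ℝ (Fin n) × ℝ =>
      maxSafeControls f U T l p.1 p.2) (X ×ˢ Ico 0 T)) :
    IsInactiveConstraint f U T X (maxSafeControls f U T l) where
  eq_of_nonempty _ hx _ ht hne := maxSafeControls_eq_of_nonempty hf hX hl hx ht hne
  nonempty_of_isTrajectory _ hx _ ht hne _ _ h _ hτ :=
    h.maxSafeControls_nonempty hf hX hl hlhc hx ht hne hτ

namespace IsInactiveConstraint

variable {C : EuclideanSpace ℝ (Fin n) → ℝ → Set (EuclideanSpace ℝ (Fin m))}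
  {x : EuclideanSpace ℝ (Fin n)} {t τ : ℝ} {u : ℝ → EuclideanSpace ℝ (Fin m)}
  {ξ : ℝ → EuclideanSpace ℝ (Fin n)}

lemma problemDomain_subset (hC : IsInactiveConstraint f U T X C) :
    problemDomain X T C ⊆ problemDomain X T (fun _ _ => U) := fun p hp =>
  ⟨hp.1, hp.2.1, fun ht =>
    hC.eq_of_nonempty p.1 hp.1 p.2 ⟨hp.2.1.1, ht⟩ (hp.2.2 ht) ▸ hp.2.2 ht⟩

lemma mem_problemDomain (hC : IsInactiveConstraint f U T X C) (hX : IsStateSpace f U T X)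
    (hxt : (x, t) ∈ problemDomain X T C) (h : IsTrajectory f U T x t u ξ) (hτ : τ ∈ Icc t T) :
    (ξ τ, τ) ∈ problemDomain X T C :=
  ⟨hX x hxt.1 t hxt.2.1 u ξ h τ hτ, ⟨hxt.2.1.1.trans hτ.1, hτ.2⟩, fun hτT =>
    hC.nonempty_of_isTrajectory x hxt.1 t hxt.2.1 (hxt.2.2 (hτ.1.trans_lt hτT)) u ξ h τ
      ⟨hτ.1, hτT⟩⟩

lemma control_mem (hC : IsInactiveConstraint f U T X C) (hX : IsStateSpace f U T X)
    (hxt : (x, t) ∈ problemDomain X T C) (h : IsTrajectory f U T x t u ξ) (hτ : τ ∈ Ico t T) :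
    u τ ∈ C (ξ τ) τ := by
  have hmem := hC.mem_problemDomain hX hxt h (Ico_subset_Icc_self hτ)
  rw [hC.eq_of_nonempty _ hmem.1 τ ⟨hmem.2.1.1, hτ.2⟩ (hmem.2.2 hτ.2)]
  exact h.control_mem τ hτ

end IsInactiveConstraint

end InactiveConstraint

section Value

open MeasureTheory
open scoped NNReal

/-- The cost of the state curve `ξ` and the control `u` from time `t` on: the running cost `r`
integrated up to the final time `T`, plus the final cost `φ`. -/
noncomputable def totalCost {A B : Type*} (r : A → B → ℝ) (φ : A → ℝ) (T t : ℝ) (u : ℝ → B)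
    (ξ : ℝ → A) : ℝ :=
  (∫ τ in t..T, r (ξ τ) (u τ)) + φ (ξ T)

/-- The value function of the problem without constraints on the control. It is real-valued; its
infimum is that of a set bounded below as soon as `r` and `φ` are bounded. -/
noncomputable def freeValue {n m : ℕ}
    (f : EuclideanSpace ℝ (Fin n) → EuclideanSpace ℝ (Fin m) → EuclideanSpace ℝ (Fin n))
    (U : Set (EuclideanSpace ℝ (Fin m))) (T : ℝ)
    (r : EuclideanSpace ℝ (Fin n) → EuclideanSpace ℝ (Fin m) → ℝ)
    (φ : EuclideanSpace ℝ (Fin n) → ℝ) (x : EuclideanSpace ℝ (Fin n)) (t : ℝ) : ℝ :=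
  sInf {c | ∃ u ξ, IsTrajectory f U T x t u ξ ∧ c = totalCost r φ T t u ξ}

section TotalCost

variable {A B : Type*} [NormedAddCommGroup A] [MeasurableSpace A] [BorelSpace A]
  [SecondCountableTopology A] [PseudoMetricSpace B] [MeasurableSpace B] [BorelSpace B]
  [SecondCountableTopology B] {X : Set A} {U : Set B} {r : A → B → ℝ} {φ : A → ℝ}
  {R L Lφ : ℝ≥0} {T t s : ℝ} {u v : ℝ → B} {ξ η : ℝ → A}

lemma totalCost_eq_add (hr : IsBoundedLipschitzOn r X U R L) (h : IsAdmissibleOn X U t T ξ u)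
    (hs : s ∈ Icc t T) :
    totalCost r φ T t u ξ = (∫ τ in t..s, r (ξ τ) (u τ)) + totalCost r φ T s u ξ := by
  rw [totalCost, totalCost, ← intervalIntegral.integral_add_adjacent_intervals
    (hr.intervalIntegrable (h.mono le_rfl hs.2) hs.1)
    (hr.intervalIntegrable (h.mono hs.1 le_rfl) hs.2), add_assoc]

lemma abs_totalCost_sub_le (hr : IsBoundedLipschitzOn r X U R L) (hφ : LipschitzOnWith Lφ φ X)
    (hξ : IsAdmissibleOn X U t T ξ u) (hη : IsAdmissibleOn X U t T η v)
    (huv : EqOn u v (Ioo t T)) (htT : t ≤ T) (hξT : ξ T ∈ X) (hηT : η T ∈ X) {δ : ℝ}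
    (hδ : ∀ τ ∈ Icc t T, ‖ξ τ - η τ‖ ≤ δ) :
    |totalCost r φ T t u ξ - totalCost r φ T t v η| ≤ (L * (T - t) + Lφ) * δ := by
  have hηu : IsAdmissibleOn X U t T η u :=
    ⟨hη.continuousOn, hξ.measurable, fun τ hτ => ⟨(hη.mem τ hτ).1, (hξ.mem τ hτ).2⟩⟩
  have hcongr : ∫ τ in t..T, r (η τ) (v τ) = ∫ τ in t..T, r (η τ) (u τ) :=
    intervalIntegral.integral_congr_Ioo_of_le htT fun τ hτ => by simp only [huv hτ]
  rw [totalCost, totalCost, hcongr, add_sub_add_comm]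
  calc _ ≤ L * δ * (T - t) + Lφ * δ := norm_add_le_of_le
        (hr.norm_integral_sub_integral_le hξ hηu htT fun τ hτ => hδ τ (Ioo_subset_Icc_self hτ))
        ((hφ.norm_sub_le hξT hηT).trans
          (mul_le_mul_of_nonneg_left (hδ T ⟨htT, le_rfl⟩) Lφ.2))
    _ = _ := by ring

end TotalCost

variable {n m : ℕ}
  {f : EuclideanSpace ℝ (Fin n) → EuclideanSpace ℝ (Fin m) → EuclideanSpace ℝ (Fin n)}
  {U : Set (EuclideanSpace ℝ (Fin m))} {T : ℝ} {X : Set (EuclideanSpace ℝ (Fin n))}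
  {M K R L Lφ : ℝ≥0} {Cφ : ℝ} {r : EuclideanSpace ℝ (Fin n) → EuclideanSpace ℝ (Fin m) → ℝ}
  {φ : EuclideanSpace ℝ (Fin n) → ℝ} {x y : EuclideanSpace ℝ (Fin n)} {t s : ℝ}
  {u v : ℝ → EuclideanSpace ℝ (Fin m)} {ξ η : ℝ → EuclideanSpace ℝ (Fin n)}

namespace IsTrajectory

lemma abs_totalCost_le (h : IsTrajectory f U T x t u ξ) (hX : IsStateSpace f U T X)
    (hr : IsBoundedLipschitzOn r X U R L) (hφ : ∀ x ∈ X, |φ x| ≤ Cφ) (hx : x ∈ X)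
    (ht : t ∈ Icc 0 T) : |totalCost r φ T t u ξ| ≤ R * T + Cφ := by
  have hξX := hX x hx t ht u ξ h
  refine (abs_add_le _ _).trans (add_le_add ?_ (hφ _ (hξX T ⟨ht.2, le_rfl⟩)))
  refine (hr.norm_integral_le (h.isAdmissibleOn hξX le_rfl le_rfl) ht.2).trans ?_
  gcongr
  exact sub_le_self T ht.1

lemma totalCost_piecewise (h : IsTrajectory f U T x t u ξ)
    (h' : IsTrajectory f U T (ξ s) s v η) (hf : IsBoundedLipschitzOn f univ U M K)
    (hX : IsStateSpace f U T X) (hr : IsBoundedLipschitzOn r X U R L) (hx : x ∈ X)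
    (ht : t ∈ Icc 0 T) (hs : s ∈ Icc t T) :
    totalCost r φ T t ((Iio s).piecewise u v) ((Iio s).piecewise ξ η) =
      (∫ τ in t..s, r (ξ τ) (u τ)) + totalCost r φ T s v η := by
  have hc := h.concat h' hf hs
  rw [totalCost_eq_add hr (hc.isAdmissibleOn (hX x hx t ht _ _ hc) le_rfl le_rfl) hs]
  congr 1
  · exact intervalIntegral.integral_congr_Ioo_of_le hs.1 fun τ hτ => by
      simp only [piecewise_Iio_of_lt _ _ hτ.2]
  · rw [totalCost, totalCost, piecewise_Iio_of_le _ _ hs.2]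
    congr 1
    exact intervalIntegral.integral_congr_Ioo_of_le hs.2 fun τ hτ => by
      simp only [piecewise_Iio_of_le _ _ hτ.1.le]

lemma totalCost_le_add (h : IsTrajectory f U T x t u ξ) (h' : IsTrajectory f U T y s v η)
    (hX : IsStateSpace f U T X) (hr : IsBoundedLipschitzOn r X U R L)
    (hφ : LipschitzOnWith Lφ φ X) (hx : x ∈ X) (hy : y ∈ X) (ht : t ∈ Icc 0 T)
    (hs : s ∈ Icc 0 T) (huv : EqOn u v (Ici t)) {δ : ℝ}
    (hδ : ∀ τ ∈ Icc s T, ‖ξ (max τ t) - η τ‖ ≤ δ) :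
    totalCost r φ T s v η ≤ totalCost r φ T t u ξ + (R * |t - s| + (L * T + Lφ) * δ) := by
  have hta : t ≤ max s t := le_max_right _ _
  have hsa : s ≤ max s t := le_max_left _ _
  have haT : max s t ≤ T := max_le hs.2 ht.2
  have hξX := hX x hx t ht u ξ h
  have hηX := hX y hy s hs v η h'
  have hξu := h.isAdmissibleOn hξX le_rfl le_rfl
  have hηv := h'.isAdmissibleOn hηX le_rfl le_rfl
  have hξ_before := abs_le.1 (hr.norm_integral_le (hξu.mono le_rfl haT) hta)
  have hη_before := abs_le.1 (hr.norm_integral_le (hηv.mono le_rfl haT) hsa)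
  have htime : R * (max s t - t) + R * (max s t - s) = R * |t - s| := by
    rw [← mul_add]
    congr 1
    linarith [max_sub_min_eq_abs s t, min_add_max s t]
  have htail := abs_le.1 <| abs_totalCost_sub_le hr hφ (hξu.mono hta le_rfl)
    (hηv.mono hsa le_rfl) (fun τ hτ => huv (hta.trans hτ.1.le)) haT (hξX T ⟨ht.2, le_rfl⟩)
    (hηX T ⟨hs.2, le_rfl⟩) fun τ hτ => by
      simpa only [max_eq_left (hta.trans hτ.1)] using hδ τ ⟨hsa.trans hτ.1, hτ.2⟩
  have hδ0 : 0 ≤ δ := (norm_nonneg _).trans (hδ T ⟨hs.2, le_rfl⟩)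
  have hLT : (L * (T - max s t) + Lφ) * δ ≤ (L * T + Lφ) * δ := by
    gcongr
    exact sub_le_self T (ht.1.trans hta)
  rw [totalCost_eq_add hr hξu ⟨hta, haT⟩, totalCost_eq_add hr hηv ⟨hsa, haT⟩]
  linarith [hξ_before.1, hη_before.2, htail.1]

end IsTrajectory

lemma bddBelow_totalCost (hX : IsStateSpace f U T X) (hr : IsBoundedLipschitzOn r X U R L)
    (hφ : ∀ x ∈ X, |φ x| ≤ Cφ) (hx : x ∈ X) (ht : t ∈ Icc 0 T) :
    BddBelow {c | ∃ u ξ, IsTrajectory f U T x t u ξ ∧ c = totalCost r φ T t u ξ} := by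
  refine ⟨-(R * T + Cφ), ?_⟩
  rintro _ ⟨u, ξ, h, rfl⟩
  exact neg_le_of_abs_le (h.abs_totalCost_le hX hr hφ hx ht)

lemma IsTrajectory.freeValue_le (h : IsTrajectory f U T x t u ξ) (hX : IsStateSpace f U T X)
    (hr : IsBoundedLipschitzOn r X U R L) (hφ : ∀ x ∈ X, |φ x| ≤ Cφ) (hx : x ∈ X)
    (ht : t ∈ Icc 0 T) : freeValue f U T r φ x t ≤ totalCost r φ T t u ξ :=
  csInf_le (bddBelow_totalCost hX hr hφ hx ht) ⟨u, ξ, h, rfl⟩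

lemma le_freeValue (hf : IsBoundedLipschitzOn f univ U M K)
    (hxt : (x, t) ∈ problemDomain X T (fun _ _ => U)) {b : ℝ}
    (hb : ∀ u ξ, IsTrajectory f U T x t u ξ → b ≤ totalCost r φ T t u ξ) :
    b ≤ freeValue f U T r φ x t := by
  obtain ⟨u, ξ, h⟩ := exists_isTrajectory hf hxt.2.1.2 hxt.2.2 x
  refine le_csInf ⟨_, u, ξ, h, rfl⟩ ?_
  rintro _ ⟨u, ξ, h, rfl⟩
  exact hb u ξ h

lemma abs_freeValue_le (hf : IsBoundedLipschitzOn f univ U M K) (hX : IsStateSpace f U T X)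
    (hr : IsBoundedLipschitzOn r X U R L) (hφ : ∀ x ∈ X, |φ x| ≤ Cφ)
    (hxt : (x, t) ∈ problemDomain X T (fun _ _ => U)) :
    |freeValue f U T r φ x t| ≤ R * T + Cφ := by
  obtain ⟨hx, ht, hU⟩ := hxt
  obtain ⟨u, ξ, h⟩ := exists_isTrajectory hf ht.2 hU x
  refine abs_le.2 ⟨le_freeValue hf ⟨hx, ht, hU⟩ fun u ξ h => ?_,
    (h.freeValue_le hX hr hφ hx ht).trans (le_of_abs_le (h.abs_totalCost_le hX hr hφ hx ht))⟩
  exact neg_le_of_abs_le (h.abs_totalCost_le hX hr hφ hx ht)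

lemma freeValue_le_add (hf : IsBoundedLipschitzOn f univ U M K) (hX : IsStateSpace f U T X)
    (hr : IsBoundedLipschitzOn r X U R L) (hφ : ∀ x ∈ X, |φ x| ≤ Cφ)
    (hφL : LipschitzOnWith Lφ φ X) (hxt : (x, t) ∈ problemDomain X T (fun _ _ => U))
    (hys : (y, s) ∈ problemDomain X T (fun _ _ => U)) :
    freeValue f U T r φ x t ≤ freeValue f U T r φ y s +
      (R + (L * T + Lφ) * ((1 + M) * Real.exp (K * T))) * dist (x, t) (y, s) := by
  rw [← sub_le_iff_le_add]
  refine le_freeValue hf hys fun v η hη => sub_le_iff_le_add.2 ?_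
  obtain ⟨u, ξ, h, hvu, hshadow⟩ :=
    exists_isTrajectory_shadow hη hf hys.2.1 hxt.2.1 hxt.2.2 x
  rw [dist_comm] at hshadow
  have hts : |s - t| ≤ dist (x, t) (y, s) := abs_sub_comm t s ▸ le_max_right _ _
  calc freeValue f U T r φ x t
      ≤ totalCost r φ T t u ξ := h.freeValue_le hX hr hφ hxt.1 hxt.2.1
    _ ≤ totalCost r φ T s v η + (R * |s - t| +
          (L * T + Lφ) * ((1 + M) * dist (x, t) (y, s) * Real.exp (K * T))) :=
        hη.totalCost_le_add h hX hr hφL hys.1 hxt.1 hys.2.1 hxt.2.1 hvu hshadow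
    _ ≤ totalCost r φ T s v η + (R * dist (x, t) (y, s) +
          (L * T + Lφ) * ((1 + M) * dist (x, t) (y, s) * Real.exp (K * T))) := by gcongr
    _ = _ := by ring

lemma uniformContinuousOn_freeValue (hf : IsBoundedLipschitzOn f univ U M K)
    (hX : IsStateSpace f U T X) (hr : IsBoundedLipschitzOn r X U R L)
    (hφ : ∀ x ∈ X, |φ x| ≤ Cφ) (hφL : LipschitzOnWith Lφ φ X) :
    UniformContinuousOn (fun p : EuclideanSpace ℝ (Fin n) × ℝ => freeValue f U T r φ p.1 p.2)
      (problemDomain X T (fun _ _ => U)) :=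
  (LipschitzOnWith.of_le_add_mul' _ fun _ hp _ hq =>
    freeValue_le_add hf hX hr hφ hφL hp hq).uniformContinuousOn

lemma IsTrajectory.freeValue_le_integral_add (h : IsTrajectory f U T x t u ξ)
    (hf : IsBoundedLipschitzOn f univ U M K) (hX : IsStateSpace f U T X)
    (hr : IsBoundedLipschitzOn r X U R L) (hφ : ∀ x ∈ X, |φ x| ≤ Cφ) (hx : x ∈ X)
    (ht : t ∈ Icc 0 T) (hs : s ∈ Icc t T) :
    freeValue f U T r φ x t ≤ (∫ τ in t..s, r (ξ τ) (u τ)) + freeValue f U T r φ (ξ s) s := by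
  rw [← sub_le_iff_le_add']
  refine le_freeValue hf (h.mem_problemDomain hX hx ht hs) fun v η hη => ?_
  rw [sub_le_iff_le_add', ← h.totalCost_piecewise hη hf hX hr hx ht hs]
  exact (h.concat hη hf hs).freeValue_le hX hr hφ hx ht

lemma exists_integral_add_freeValue_lt (hf : IsBoundedLipschitzOn f univ U M K)
    (hX : IsStateSpace f U T X) (hr : IsBoundedLipschitzOn r X U R L)
    (hφ : ∀ x ∈ X, |φ x| ≤ Cφ) (hxt : (x, t) ∈ problemDomain X T (fun _ _ => U)) {ε : ℝ}
    (hε : 0 < ε) (hs : s ∈ Icc t T) :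
    ∃ u ξ, IsTrajectory f U T x t u ξ ∧
      (∫ τ in t..s, r (ξ τ) (u τ)) + freeValue f U T r φ (ξ s) s <
        freeValue f U T r φ x t + ε := by
  obtain ⟨u, ξ, h, hlt⟩ : ∃ u ξ, IsTrajectory f U T x t u ξ ∧
      totalCost r φ T t u ξ < freeValue f U T r φ x t + ε := by
    by_contra! hge
    linarith [le_freeValue hf hxt hge]
  obtain ⟨hx, ht, -⟩ := hxt
  have hξX := hX x hx t ht u ξ h
  refine ⟨u, ξ, h, lt_of_le_of_lt ?_ hlt⟩
  rw [totalCost_eq_add hr (h.isAdmissibleOn hξX le_rfl le_rfl) hs]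
  gcongr
  exact (h.restrict hf hs.1).freeValue_le hX hr hφ (hξX s hs) ⟨ht.1.trans hs.1, hs.2⟩

theorem IsInactiveConstraint.constrainedValue_eq_coe_freeValue
    {C : EuclideanSpace ℝ (Fin n) → ℝ → Set (EuclideanSpace ℝ (Fin m))}
    (hC : IsInactiveConstraint f U T X C) (hf : IsBoundedLipschitzOn f univ U M K)
    (hX : IsStateSpace f U T X) (hr : IsBoundedLipschitzOn r X U R L)
    (hφ : ∀ x ∈ X, |φ x| ≤ Cφ) (hxt : (x, t) ∈ problemDomain X T C) :
    constrainedValue f U T r φ C x t = freeValue f U T r φ x t := by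
  obtain ⟨hx, ht, hU⟩ := hC.problemDomain_subset hxt
  obtain ⟨u, ξ, h⟩ := exists_isTrajectory hf ht.2 hU x
  have hne : {c | ∃ u ξ, IsTrajectory f U T x t u ξ ∧ c = totalCost r φ T t u ξ}.Nonempty :=
    ⟨_, u, ξ, h, rfl⟩
  rw [freeValue, EReal.coe_strictMono.monotone.map_csInf_of_continuousAt
    continuous_coe_real_ereal.continuousAt hne (bddBelow_totalCost hX hr hφ hx ht),
    constrainedValue]
  congr 1
  ext c
  constructor
  · rintro ⟨u, ξ, h, -, rfl⟩
    exact ⟨_, ⟨u, ξ, h, rfl⟩, rfl⟩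
  · rintro ⟨_, ⟨u, ξ, h, rfl⟩, rfl⟩
    exact ⟨u, ξ, h, fun τ hτ => hC.control_mem hX hxt h hτ, rfl⟩

lemma constrainedValue_final
    (C : EuclideanSpace ℝ (Fin n) → ℝ → Set (EuclideanSpace ℝ (Fin m)))
    (x : EuclideanSpace ℝ (Fin n)) : constrainedValue f U T r φ C x T = φ x := by
  have hconst : IsTrajectory f U T x T (fun _ => 0) (fun _ => x) :=
    ⟨measurable_const, by simp, continuousOn_const, by simp⟩
  refine IsLeast.csInf_eq ⟨⟨_, _, hconst, by simp, by simp⟩, ?_⟩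
  rintro _ ⟨u, ξ, h, -, rfl⟩
  simp [h.apply_left le_rfl]

end Value

section Viscosity

open MeasureTheory
open scoped NNReal

/-- The control-dependent Hamiltonian `f(x,u) · p + r(x,u)`, whose infimum over the admissible
controls `u` is `hamiltonian`. -/
noncomputable def controlHamiltonian {E B : Type*} [NormedAddCommGroup E] [InnerProductSpace ℝ E]
    (f : E → B → E) (r : E → B → ℝ) (p x : E) (u : B) : ℝ :=
  inner ℝ (f x u) p + r x u

lemma IsBoundedLipschitzOn.controlHamiltonian {E B : Type*} [NormedAddCommGroup E]
    [InnerProductSpace ℝ E] [PseudoMetricSpace B] {f : E → B → E} {r : E → B → ℝ} {X : Set E}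
    {U : Set B} {M K R L : ℝ≥0} (hf : IsBoundedLipschitzOn f X U M K)
    (hr : IsBoundedLipschitzOn r X U R L) (p : E) :
    IsBoundedLipschitzOn (controlHamiltonian f r p) X U (M * ‖p‖₊ + R) (‖p‖₊ * K + L) where
  norm_le x hx w hw := norm_add_le_of_le
    ((norm_inner_le_norm _ _).trans
      (mul_le_mul_of_nonneg_right (hf.norm_le x hx w hw) (norm_nonneg p)))
    (hr.norm_le x hx w hw)
  lipschitzOnWith := by
    have hinner : LipschitzWith ‖p‖₊ fun v : E => inner ℝ v p :=
      LipschitzWith.of_dist_le_mul fun v w => by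
        rw [Real.dist_eq, ← inner_sub_left, dist_eq_norm, coe_nnnorm, mul_comm]
        exact abs_real_inner_le_norm _ _
    exact (hinner.comp_lipschitzOnWith hf.lipschitzOnWith).add hr.lipschitzOnWith

lemma eventually_abs_sub_gradient_le {E : Type*} [NormedAddCommGroup E]
    [InnerProductSpace ℝ E] [CompleteSpace E] {ψ : E × ℝ → ℝ} {x : E} {t : ℝ}
    (hψ : DifferentiableAt ℝ ψ (x, t)) {c : ℝ} (hc : 0 < c) :
    ∀ᶠ q in 𝓝 (x, t), |ψ q - ψ (x, t) - ((q.2 - t) * deriv (fun s => ψ (x, s)) t +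
      inner ℝ (q.1 - x) (gradient (fun y => ψ (y, t)) x))| ≤ c * ‖q - (x, t)‖ := by
  have hD := hψ.hasFDerivAt
  have hDx : HasFDerivAt (fun y => ψ (y, t))
      ((fderiv ℝ ψ (x, t)).comp (ContinuousLinearMap.inl ℝ E ℝ)) x :=
    hD.comp x (hasFDerivAt_prodMk_left x t)
  have hDt : HasFDerivAt (fun s => ψ (x, s))
      ((fderiv ℝ ψ (x, t)).comp (ContinuousLinearMap.inr ℝ E ℝ)) t :=
    hD.comp t (hasFDerivAt_prodMk_right x t)
  have hsplit : ∀ v : E, ∀ a : ℝ, fderiv ℝ ψ (x, t) (v, a) =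
      a * deriv (fun s => ψ (x, s)) t + inner ℝ v (gradient (fun y => ψ (y, t)) x) := by
    intro v a
    rw [real_inner_comm, ← InnerProductSpace.toDual_apply_apply, toDual_gradient, hDx.fderiv,
      hDt.hasDerivAt.deriv, ← smul_eq_mul, ← map_smul, ContinuousLinearMap.comp_apply,
      ContinuousLinearMap.comp_apply, ← map_add]
    simp
  filter_upwards [hD.isLittleO.def hc] with q hq
  rwa [← hsplit]

section LocalExtr

variable {α : Type*} [TopologicalSpace α] {V : α → EReal} {v ψ : α → ℝ} {S : Set α} {a : α}

lemma isLocalMaxOn_sub_of_coe (h : IsLocalMaxOn (fun p => V p - (ψ p : EReal)) S a)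
    (hV : ∀ p ∈ S, V p = v p) (ha : a ∈ S) : IsLocalMaxOn (fun p => v p - ψ p) S a := by
  filter_upwards [h, self_mem_nhdsWithin] with p hp hpS
  rw [hV p hpS, hV a ha] at hp
  exact_mod_cast hp

lemma isLocalMinOn_sub_of_coe (h : IsLocalMinOn (fun p => V p - (ψ p : EReal)) S a)
    (hV : ∀ p ∈ S, V p = v p) (ha : a ∈ S) : IsLocalMinOn (fun p => v p - ψ p) S a := by
  filter_upwards [h, self_mem_nhdsWithin] with p hp hpS
  rw [hV p hpS, hV a ha] at hp
  exact_mod_cast hp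

end LocalExtr

variable {n m : ℕ}
  {f : EuclideanSpace ℝ (Fin n) → EuclideanSpace ℝ (Fin m) → EuclideanSpace ℝ (Fin n)}
  {U : Set (EuclideanSpace ℝ (Fin m))} {T : ℝ} {X : Set (EuclideanSpace ℝ (Fin n))}
  {M K R L Lφ : ℝ≥0} {Cφ : ℝ} {r : EuclideanSpace ℝ (Fin n) → EuclideanSpace ℝ (Fin m) → ℝ}
  {φ : EuclideanSpace ℝ (Fin n) → ℝ} {x : EuclideanSpace ℝ (Fin n)} {t s : ℝ}
  {u : ℝ → EuclideanSpace ℝ (Fin m)} {ξ : ℝ → EuclideanSpace ℝ (Fin n)}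
  {S : Set (EuclideanSpace ℝ (Fin n) × ℝ)} {ψ : EuclideanSpace ℝ (Fin n) × ℝ → ℝ}

namespace IsTrajectory

lemma norm_prodMk_sub_le (h : IsTrajectory f U T x t u ξ)
    (hf : IsBoundedLipschitzOn f univ U M K) (hs : s ∈ Icc t T) :
    ‖(ξ s, s) - (x, t)‖ ≤ (1 + M) * (s - t) := by
  have hst : 0 ≤ s - t := sub_nonneg.2 hs.1
  rw [Prod.mk_sub_mk, Prod.norm_mk, Real.norm_of_nonneg hst]
  refine max_le ((h.norm_sub_le hf hs).trans ?_) (le_mul_of_one_le_left hst ?_)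
  · gcongr
    exact le_add_of_nonneg_left zero_le_one
  · exact le_add_of_nonneg_right M.2

lemma inner_sub_add_integral_eq (h : IsTrajectory f U T x t u ξ)
    (hf : IsBoundedLipschitzOn f univ U M K) (hX : IsStateSpace f U T X)
    (hr : IsBoundedLipschitzOn r X U R L) (hx : x ∈ X) (ht : t ∈ Icc 0 T) (hs : s ∈ Icc t T)
    (p : EuclideanSpace ℝ (Fin n)) :
    inner ℝ (ξ s - x) p + ∫ τ in t..s, r (ξ τ) (u τ) =
      ∫ τ in t..s, controlHamiltonian f r p (ξ τ) (u τ) := by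
  have hfint := hf.intervalIntegrable (h.isAdmissibleOn_univ le_rfl hs.2) hs.1
  have hrint := hr.intervalIntegrable (h.isAdmissibleOn (hX x hx t ht u ξ h) le_rfl hs.2) hs.1
  have hinner : inner ℝ (ξ s - x) p = ∫ τ in t..s, inner ℝ (f (ξ τ) (u τ)) p := by
    rw [← h.apply_left ht.2, h.sub_eq_integral hf le_rfl hs.1 hs.2]
    simp only [real_inner_comm p]
    exact ((innerSL ℝ p).intervalIntegral_comp_comm hfint).symm
  have hinnerint : IntervalIntegrable (fun τ => inner ℝ (f (ξ τ) (u τ)) p) volume t s :=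
    ⟨Integrable.inner_const (𝕜 := ℝ) hfint.1 p, Integrable.inner_const (𝕜 := ℝ) hfint.2 p⟩
  rw [hinner, ← intervalIntegral.integral_add hinnerint hrint]
  rfl

lemma isAdmissibleOn_const (h : IsTrajectory f U T x t u ξ) (hx : x ∈ X) (hs : s ≤ T) :
    IsAdmissibleOn X U t s (fun _ => x) u where
  continuousOn := continuousOn_const
  measurable := h.measurable_control
  mem τ hτ := ⟨hx, h.control_mem τ ⟨hτ.1.le, hτ.2.trans_le hs⟩⟩

lemma abs_integral_controlHamiltonian_sub_le (h : IsTrajectory f U T x t u ξ)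
    (hf : IsBoundedLipschitzOn f univ U M K) (hX : IsStateSpace f U T X)
    (hr : IsBoundedLipschitzOn r X U R L) (hx : x ∈ X) (ht : t ∈ Icc 0 T) (hs : s ∈ Icc t T)
    (p : EuclideanSpace ℝ (Fin n)) :
    |(∫ τ in t..s, controlHamiltonian f r p (ξ τ) (u τ)) -
        ∫ τ in t..s, controlHamiltonian f r p x (u τ)| ≤
      (‖p‖₊ * K + L : ℝ≥0) * (M * (s - t)) * (s - t) := by
  have hξ := h.isAdmissibleOn (hX x hx t ht u ξ h) le_rfl hs.2
  refine ((hf.mono (subset_univ X)).controlHamiltonian hr p).norm_integral_sub_integral_le hξ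
    (h.isAdmissibleOn_const hx hs.2) hs.1 fun τ hτ =>
      (h.norm_sub_le hf ⟨hτ.1.le, hτ.2.le.trans hs.2⟩).trans ?_
  gcongr
  exact hτ.2.le

lemma mul_le_integral_controlHamiltonian (h : IsTrajectory f U T x t u ξ)
    (hf : IsBoundedLipschitzOn f univ U M K) (hr : IsBoundedLipschitzOn r X U R L) (hx : x ∈ X)
    (hs : s ∈ Icc t T) {p : EuclideanSpace ℝ (Fin n)} {b : ℝ}
    (hb : ∀ w ∈ U, b ≤ controlHamiltonian f r p x w) :
    (s - t) * b ≤ ∫ τ in t..s, controlHamiltonian f r p x (u τ) := by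
  have hconst := h.isAdmissibleOn_const hx hs.2
  rw [← smul_eq_mul, ← intervalIntegral.integral_const]
  exact intervalIntegral.integral_mono_on_of_le_Ioo hs.1 intervalIntegrable_const
    (((hf.mono (subset_univ X)).controlHamiltonian hr p).intervalIntegrable hconst hs.1)
    fun τ hτ => hb _ (hconst.mem τ hτ).2

end IsTrajectory

lemma eventually_forall_isTrajectory (hf : IsBoundedLipschitzOn f univ U M K) (ht : t < T)
    (hS : ∀ u ξ, IsTrajectory f U T x t u ξ → ∀ τ ∈ Icc t T, (ξ τ, τ) ∈ S)
    {P : EuclideanSpace ℝ (Fin n) × ℝ → Prop} (hP : ∀ᶠ q in 𝓝[S] (x, t), P q) :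
    ∀ᶠ ε in 𝓝[>] (0 : ℝ), ∀ u ξ, IsTrajectory f U T x t u ξ → P (ξ (t + ε), t + ε) := by
  obtain ⟨δ, hδ, hball⟩ := Metric.mem_nhdsWithin_iff.1 hP
  have hsmall : ∀ᶠ ε in 𝓝[>] (0 : ℝ), (1 + M) * ε < δ :=
    ((Continuous.tendsto' (by fun_prop) 0 0 (mul_zero _)).mono_left nhdsWithin_le_nhds).eventually
      (gt_mem_nhds hδ)
  filter_upwards [hsmall, (tendsto_const_add_nhdsGT_zero ht).eventually self_mem_nhdsWithin]
    with ε hε hmem u ξ h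
  refine hball ⟨?_, hS u ξ h _ hmem⟩
  rw [Metric.mem_ball, dist_eq_norm]
  exact (h.norm_prodMk_sub_le hf hmem).trans_lt (by rwa [add_sub_cancel_left])

lemma eventually_abs_testFunction_sub_le (hf : IsBoundedLipschitzOn f univ U M K) (ht : t < T)
    (hψ : DifferentiableAt ℝ ψ (x, t)) {c : ℝ} (hc : 0 < c) :
    ∀ᶠ ε in 𝓝[>] (0 : ℝ), ∀ u ξ, IsTrajectory f U T x t u ξ →
      |ψ (ξ (t + ε), t + ε) - ψ (x, t) - (ε * deriv (fun s => ψ (x, s)) t +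
        inner ℝ (ξ (t + ε) - x) (gradient (fun y => ψ (y, t)) x))| ≤ c * ε := by
  have hexp := eventually_forall_isTrajectory (x := x) hf ht (S := univ)
    (fun _ _ _ _ _ => mem_univ _)
    (by simpa only [nhdsWithin_univ] using
      eventually_abs_sub_gradient_le hψ (c := c / (1 + M)) (by positivity))
  filter_upwards [hexp, (tendsto_const_add_nhdsGT_zero ht).eventually self_mem_nhdsWithin]
    with ε hε hmem u ξ h
  have hnorm := h.norm_prodMk_sub_le hf hmem
  have hbound := hε u ξ h
  simp only [add_sub_cancel_left] at hnorm hbound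
  calc _ ≤ c / (1 + M) * ‖(ξ (t + ε), t + ε) - (x, t)‖ := hbound
    _ ≤ c / (1 + M) * ((1 + M) * ε) := by gcongr
    _ = c * ε := by field_simp

lemma eventually_abs_testFunction_add_integral_sub_le (hf : IsBoundedLipschitzOn f univ U M K)
    (hX : IsStateSpace f U T X) (hr : IsBoundedLipschitzOn r X U R L) (hx : x ∈ X)
    (ht : t ∈ Ico 0 T) (hψ : DifferentiableAt ℝ ψ (x, t)) {c : ℝ} (hc : 0 < c) :
    ∀ᶠ ε in 𝓝[>] (0 : ℝ), ∀ u ξ, IsTrajectory f U T x t u ξ →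
      |ψ (ξ (t + ε), t + ε) - ψ (x, t) + (∫ τ in t..t + ε, r (ξ τ) (u τ)) -
        (ε * deriv (fun s => ψ (x, s)) t +
          ∫ τ in t..t + ε, controlHamiltonian f r (gradient (fun y => ψ (y, t)) x) x (u τ))| ≤
        c * ε := by
  set p := gradient (fun y => ψ (y, t)) x
  set B : ℝ := (‖p‖₊ * K + L : ℝ≥0) * M
  have hsmall : ∀ᶠ ε in 𝓝[>] (0 : ℝ), B * ε < c / 2 :=
    ((Continuous.tendsto' (by fun_prop) 0 0 (mul_zero _)).mono_left nhdsWithin_le_nhds).eventually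
      (gt_mem_nhds (half_pos hc))
  filter_upwards [eventually_abs_testFunction_sub_le hf ht.2 hψ (half_pos hc), hsmall,
    (tendsto_const_add_nhdsGT_zero ht.2).eventually self_mem_nhdsWithin, self_mem_nhdsWithin]
    with ε hε hεc hmem hε0 u ξ h
  have hfreeze :=
    h.abs_integral_controlHamiltonian_sub_le hf hX hr hx (Ico_subset_Icc_self ht) hmem p
  rw [← h.inner_sub_add_integral_eq hf hX hr hx (Ico_subset_Icc_self ht) hmem p,
    add_sub_cancel_left] at hfreeze
  have hfreeze' : (‖p‖₊ * K + L : ℝ≥0) * (M * ε) * ε ≤ c / 2 * ε := by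
    rw [← mul_assoc]
    exact mul_le_mul_of_nonneg_right hεc.le (le_of_lt hε0)
  have hsum := (abs_add_le _ _).trans (add_le_add (hε u ξ h) (hfreeze.trans hfreeze'))
  rw [← add_mul, add_halves] at hsum
  exact (congrArg abs (by ring)).trans_le hsum

lemma nonneg_of_isLocalMaxOn_freeValue (hf : IsBoundedLipschitzOn f univ U M K)
    (hX : IsStateSpace f U T X) (hr : IsBoundedLipschitzOn r X U R L)
    (hφ : ∀ x ∈ X, |φ x| ≤ Cφ) (hx : x ∈ X) (ht : t ∈ Ico 0 T)
    (hS : ∀ u ξ, IsTrajectory f U T x t u ξ → ∀ τ ∈ Icc t T, (ξ τ, τ) ∈ S)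
    (hψ : DifferentiableAt ℝ ψ (x, t))
    (hmax : IsLocalMaxOn (fun q => freeValue f U T r φ q.1 q.2 - ψ q) S (x, t))
    {w : EuclideanSpace ℝ (Fin m)} (hw : w ∈ U) :
    0 ≤ deriv (fun s => ψ (x, s)) t +
      controlHamiltonian f r (gradient (fun y => ψ (y, t)) x) x w := by
  refine le_of_forall_pos_le_add fun c hc => ?_
  obtain ⟨ε, hmaxε, hexp, hmem, hε⟩ := ((eventually_forall_isTrajectory hf ht.2 hS hmax).and <|
    (eventually_abs_testFunction_add_integral_sub_le hf hX hr hx ht hψ hc).and <|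
    ((tendsto_const_add_nhdsGT_zero ht.2).eventually self_mem_nhdsWithin).and
      self_mem_nhdsWithin).exists
  obtain ⟨ξ, h⟩ := exists_isTrajectory_of_control hf (measurable_const (a := w)) ht.2.le
    (fun _ _ => hw) x
  have hdpp := h.freeValue_le_integral_add hf hX hr hφ hx (Ico_subset_Icc_self ht) hmem
  have hloc := hmaxε _ ξ h
  have hexpξ := (abs_le.1 (hexp _ ξ h)).2
  rw [intervalIntegral.integral_const, add_sub_cancel_left, smul_eq_mul] at hexpξ
  refine nonneg_of_mul_nonneg_right (a := ε) ?_ hε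
  linarith

lemma nonpos_of_isLocalMinOn_freeValue (hf : IsBoundedLipschitzOn f univ U M K)
    (hX : IsStateSpace f U T X) (hr : IsBoundedLipschitzOn r X U R L)
    (hφ : ∀ x ∈ X, |φ x| ≤ Cφ) (hx : x ∈ X) (ht : t ∈ Ico 0 T) (hU : U.Nonempty)
    (hS : ∀ u ξ, IsTrajectory f U T x t u ξ → ∀ τ ∈ Icc t T, (ξ τ, τ) ∈ S)
    (hψ : DifferentiableAt ℝ ψ (x, t))
    (hmin : IsLocalMinOn (fun q => freeValue f U T r φ q.1 q.2 - ψ q) S (x, t)) {b : ℝ}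
    (hb : ∀ w ∈ U, b ≤ controlHamiltonian f r (gradient (fun y => ψ (y, t)) x) x w) :
    deriv (fun s => ψ (x, s)) t + b ≤ 0 := by
  refine le_of_forall_pos_le_add fun c hc => ?_
  obtain ⟨ε, hminε, hexp, hmem, hε⟩ := ((eventually_forall_isTrajectory hf ht.2 hS hmin).and <|
    (eventually_abs_testFunction_add_integral_sub_le hf hX hr hx ht hψ (half_pos hc)).and <|
    ((tendsto_const_add_nhdsGT_zero ht.2).eventually self_mem_nhdsWithin).and
      self_mem_nhdsWithin).exists
  obtain ⟨u, ξ, h, hdpp⟩ := exists_integral_add_freeValue_lt hf hX hr hφ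
    (t := t) ⟨hx, Ico_subset_Icc_self ht, fun _ => hU⟩ (mul_pos (half_pos hc) hε) hmem
  have hloc := hminε u ξ h
  have hexpξ := (abs_le.1 (hexp u ξ h)).1
  have hint := h.mul_le_integral_controlHamiltonian hf hr hx hmem hb
  rw [add_sub_cancel_left] at hint
  refine le_of_mul_le_mul_left (a := ε) ?_ hε
  linarith

namespace IsInactiveConstraint

variable {C : EuclideanSpace ℝ (Fin n) → ℝ → Set (EuclideanSpace ℝ (Fin m))}

lemma hamiltonian_nonneg_of_isLocalMaxOn (hC : IsInactiveConstraint f U T X C)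
    (hf : IsBoundedLipschitzOn f univ U M K) (hX : IsStateSpace f U T X)
    (hr : IsBoundedLipschitzOn r X U R L) (hφ : ∀ x ∈ X, |φ x| ≤ Cφ) (hx : x ∈ X)
    (ht : t ∈ Ico 0 T) (hne : (C x t).Nonempty) (hψ : DifferentiableAt ℝ ψ (x, t))
    (hmax : IsLocalMaxOn (fun q => constrainedValue f U T r φ C q.1 q.2 - (ψ q : EReal))
      (X ×ˢ Icc 0 T) (x, t)) :
    0 ≤ deriv (fun s => ψ (x, s)) t +
      hamiltonian f r C x t (gradient (fun y => ψ (y, t)) x) := by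
  have hxt : (x, t) ∈ problemDomain X T C := ⟨hx, Ico_subset_Icc_self ht, fun _ => hne⟩
  have hmax' : IsLocalMaxOn (fun q => freeValue f U T r φ q.1 q.2 - ψ q)
      (problemDomain X T C) (x, t) :=
    isLocalMaxOn_sub_of_coe (hmax.on_subset problemDomain_subset_prod_Icc)
      (fun _ hq => hC.constrainedValue_eq_coe_freeValue hf hX hr hφ hq) hxt
  rw [← neg_le_iff_add_nonneg']
  refine le_csInf (hne.image _) ?_
  rintro _ ⟨w, hw, rfl⟩
  rw [hC.eq_of_nonempty x hx t ht hne] at hw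
  exact neg_le_iff_add_nonneg'.2 <| nonneg_of_isLocalMaxOn_freeValue hf hX hr hφ hx ht
    (fun _ _ h _ hτ => hC.mem_problemDomain hX hxt h hτ) hψ hmax' hw

lemma hamiltonian_nonpos_of_isLocalMinOn (hC : IsInactiveConstraint f U T X C)
    (hf : IsBoundedLipschitzOn f univ U M K) (hX : IsStateSpace f U T X)
    (hr : IsBoundedLipschitzOn r X U R L) (hφ : ∀ x ∈ X, |φ x| ≤ Cφ) (hx : x ∈ X)
    (ht : t ∈ Ico 0 T) (hne : (C x t).Nonempty) (hψ : DifferentiableAt ℝ ψ (x, t))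
    (hmin : IsLocalMinOn (fun q => constrainedValue f U T r φ C q.1 q.2 - (ψ q : EReal))
      (X ×ˢ Icc 0 T) (x, t)) :
    deriv (fun s => ψ (x, s)) t +
      hamiltonian f r C x t (gradient (fun y => ψ (y, t)) x) ≤ 0 := by
  have hxt : (x, t) ∈ problemDomain X T C := ⟨hx, Ico_subset_Icc_self ht, fun _ => hne⟩
  have hmin' : IsLocalMinOn (fun q => freeValue f U T r φ q.1 q.2 - ψ q)
      (problemDomain X T C) (x, t) :=
    isLocalMinOn_sub_of_coe (hmin.on_subset problemDomain_subset_prod_Icc)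
      (fun _ hq => hC.constrainedValue_eq_coe_freeValue hf hX hr hφ hq) hxt
  have hCU := hC.eq_of_nonempty x hx t ht hne
  refine nonpos_of_isLocalMinOn_freeValue hf hX hr hφ hx ht (hCU ▸ hne)
    (fun _ _ h _ hτ => hC.mem_problemDomain hX hxt h hτ) hψ hmin' fun w hw =>
      csInf_le ?_ ⟨w, hCU.symm ▸ hw, rfl⟩
  have hH := (hf.mono (subset_univ X)).controlHamiltonian hr (gradient (fun y => ψ (y, t)) x)
  rw [hCU]
  refine ⟨-((M * ‖gradient (fun y => ψ (y, t)) x‖₊ + R : ℝ≥0) : ℝ), ?_⟩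
  rintro _ ⟨v, hv, rfl⟩
  exact neg_le_of_abs_le (hH.norm_le x hx v hv)

theorem isViscositySolution (hC : IsInactiveConstraint f U T X C)
    (hf : IsBoundedLipschitzOn f univ U M K) (hX : IsStateSpace f U T X)
    (hr : IsBoundedLipschitzOn r X U R L) (hφ : ∀ x ∈ X, |φ x| ≤ Cφ)
    (hφL : LipschitzOnWith Lφ φ X) :
    IsViscositySolution X T f r φ C (constrainedValue f U T r φ C) := by
  have hV : ∀ p ∈ problemDomain X T C,
      constrainedValue f U T r φ C p.1 p.2 = freeValue f U T r φ p.1 p.2 :=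
    fun _ hp => hC.constrainedValue_eq_coe_freeValue hf hX hr hφ hp
  constructor
  case finite =>
    intro p hp
    rw [hV p hp]
    exact ⟨EReal.coe_ne_top _, EReal.coe_ne_bot _⟩
  case bounded =>
    refine ⟨R * T + Cφ, fun p hp => ?_⟩
    rw [hV p hp, EReal.toReal_coe]
    exact abs_freeValue_le hf hX hr hφ (hC.problemDomain_subset hp)
  case uniformContinuousOn =>
    refine ((uniformContinuousOn_freeValue hf hX hr hφ hφL).mono hC.problemDomain_subset).congr ?_
    intro p hp
    simp only [hV p hp, EReal.toReal_coe]
  case final => exact fun x _ => constrainedValue_final C x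
  case of_localMax =>
    intro x hx t ht hne ψ hψ hmax
    exact hC.hamiltonian_nonneg_of_isLocalMaxOn hf hX hr hφ hx ht hne
      (hψ.differentiableAt one_ne_zero) hmax
  case of_localMin =>
    intro x hx t ht hne ψ hψ hmin
    exact hC.hamiltonian_nonpos_of_isLocalMinOn hf hX hr hφ hx ht hne
      (hψ.differentiableAt one_ne_zero) hmin

end IsInactiveConstraint

end Viscosity

theorem theorem2_general {n m : ℕ}
    (X : Set (EuclideanSpace ℝ (Fin n))) (U : Set (EuclideanSpace ℝ (Fin m))) (T : ℝ)
    (f : EuclideanSpace ℝ (Fin n) → EuclideanSpace ℝ (Fin m) → EuclideanSpace ℝ (Fin n))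
    (r : EuclideanSpace ℝ (Fin n) → EuclideanSpace ℝ (Fin m) → ℝ)
    (φ l : EuclideanSpace ℝ (Fin n) → ℝ)
    (hf_bdd : ∃ M : ℝ, ∀ x, ∀ u ∈ U, ‖f x u‖ ≤ M)
    (hf_lip : ∃ K, LipschitzOnWith K (Function.uncurry f) (univ ×ˢ U))
    (hX : IsStateSpace f U T X)
    (hr_bdd : ∃ M : ℝ, ∀ x ∈ X, ∀ u ∈ U, |r x u| ≤ M)
    (hr_lip : ∃ K, LipschitzOnWith K (Function.uncurry r) (X ×ˢ U))
    (hφ_bdd : ∃ M : ℝ, ∀ x ∈ X, |φ x| ≤ M)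
    (hφ_lip : ∃ K, LipschitzOnWith K φ X)
    (hl_lip : ∃ K, LipschitzOnWith K l X)
    (hlhc : LowerHemicontinuousOn
      (fun p : EuclideanSpace ℝ (Fin n) × ℝ => maxSafeControls f U T l p.1 p.2) (X ×ˢ Ico 0 T)) :
    IsViscositySolution X T f r φ (maxSafeControls f U T l)
      (constrainedValue f U T r φ (maxSafeControls f U T l)) := by
  obtain ⟨M, hM⟩ := hf_bdd
  obtain ⟨K, hK⟩ := hf_lip
  obtain ⟨R, hR⟩ := hr_bdd
  obtain ⟨L, hL⟩ := hr_lip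
  obtain ⟨Cφ, hCφ⟩ := hφ_bdd
  obtain ⟨Lφ, hLφ⟩ := hφ_lip
  obtain ⟨Kl, hKl⟩ := hl_lip
  have hf : IsBoundedLipschitzOn f univ U M.toNNReal K :=
    ⟨fun x _ w hw => (hM x w hw).trans M.le_coe_toNNReal, hK⟩
  have hr : IsBoundedLipschitzOn r X U R.toNNReal L :=
    ⟨fun x hx w hw => (hR x hx w hw).trans R.le_coe_toNNReal, hL⟩
  exact (isInactiveConstraint_maxSafeControls hf hX hKl hlhc).isViscositySolution hf hX hr hCφ hLφ

theorem theorem2 {n m : ℕ}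
    (X : Set (EuclideanSpace ℝ (Fin n))) (U : Set (EuclideanSpace ℝ (Fin m))) (T : ℝ) (hT : 0 < T)
    (f₁ : EuclideanSpace ℝ (Fin n) → EuclideanSpace ℝ (Fin n))
    (f₂ : EuclideanSpace ℝ (Fin n) → EuclideanSpace ℝ (Fin m) →L[ℝ] EuclideanSpace ℝ (Fin n))
    (r : EuclideanSpace ℝ (Fin n) → EuclideanSpace ℝ (Fin m) → ℝ)
    (φ l : EuclideanSpace ℝ (Fin n) → ℝ)
    (hU : Convex ℝ U)
    (hf_bdd : ∃ M : ℝ, ∀ x, ∀ u ∈ U, ‖affineDynamics f₁ f₂ x u‖ ≤ M)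
    (hf_lip : ∃ K, LipschitzOnWith K (Function.uncurry (affineDynamics f₁ f₂)) (univ ×ˢ U))
    (hX : IsStateSpace (affineDynamics f₁ f₂) U T X)
    (hr_bdd : ∃ M : ℝ, ∀ x ∈ X, ∀ u ∈ U, |r x u| ≤ M)
    (hr_lip : ∃ K, LipschitzOnWith K (Function.uncurry r) (X ×ˢ U))
    (hr_conv : ∀ x ∈ X, ConvexOn ℝ U (r x))
    (hφ_bdd : ∃ M : ℝ, ∀ x ∈ X, |φ x| ≤ M)
    (hφ_lip : ∃ K, LipschitzOnWith K φ X)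
    (hl_lip : ∃ K, LipschitzOnWith K l X)
    (hlhc : LowerHemicontinuousOn
      (fun p : EuclideanSpace ℝ (Fin n) × ℝ =>
        maxSafeControls (affineDynamics f₁ f₂) U T l p.1 p.2)
      (X ×ˢ Ico 0 T)) :
    IsViscositySolution X T (affineDynamics f₁ f₂) r φ
      (maxSafeControls (affineDynamics f₁ f₂) U T l)
      (constrainedValue (affineDynamics f₁ f₂) U T r φ
        (maxSafeControls (affineDynamics f₁ f₂) U T l)) :=
  theorem2_general X U T (affineDynamics f₁ f₂) r φ l hf_bdd hf_lip hX hr_bdd hr_lip hφ_bdd hφ_lip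
    hl_lip hlhc
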